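/- **Setting.** Let $S_\rho$ be the set of rankings of $\rho$ items ($\pi(i)$ is the position of item $i$) with the Kendall tau distance $d_\tau$ (number of pairs of items ordered differently), and let $g:S_\rho\to\{\pm1\}^{\binom{\rho}{2}}$ be the embedding with $g(\pi)_{(i,j)}=1$ if $\pi(i)<\pi(j)$ and $-1$ otherwise, for $i<j$. The Mallows law with centre $y$ and parameter $\theta$ is $P_\theta(\pi\mid y)\propto e^{-\theta d_\tau(\pi,y)}$. Let $y_1\ne y_2$ in $S_\rho$, let the latent label $Y$ be $y_1$ with known probability $p\in(0,1)$ and $y_2$ with probability $1-p$, and let $\lambda^a,\lambda^b,\lambda^c$ be conditionally independent given $Y$, $\lambda^s$ having the Mallows law with centre $Y$ and parameter $\theta_s$. One observes $n\ge1$ i.i.d. samples of $(\lambda^a,\lambda^b,\lambda^c)$, but not $Y$. **Functions.** Let $h_\rho(\theta)=\mathbb E_\theta[d_\tau(\pi,y)]$ be the mean distance to the centre under the Mallows law (independent of $y$), let $h_\rho^{-1}$ be its inverse on $\theta>0$ (the backward mapping), and let $$g_\rho(U)=\frac{-\rho e^{-U}}{(1-e^{-U})^2}+\sum_{j=1}^{\rho}\frac{j^2e^{-Uj}}{(1-e^{-Uj})^2}.$$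 **Estimator.** For a pair of items $i$ and the sources $s$ (first) and $s',s''$ (the other two), let $\ell_s$ be the empirical frequency of $g(\lambda^s)_i=1$, let $O_{s,s'}$ be that of $g(\lambda^s)_i=g(\lambda^{s'})_i=1$, and put $c_{s,s'}=O_{s,s'}-\ell_s\ell_{s'}$. For a class of probability $p'$ the triplet equations of the three sources give a quadratic equation for $P(g(\lambda^s)_i=1\mid Y=y)$ with roots $$\ell_s\pm\sqrt{\frac{1-p'}{p'}\cdot\frac{c_{s,s'}\,c_{s,s''}}{c_{s',s''}}}$$ (the square root is read as $0$ if the radicand is negative or undefined). Assume that the signs are correctly recovered: for $y_1$ (with $p'=p$) the root is taken with a sign $\sigma_{s,i}\in\{\pm1\}$ satisfying $\sigma_{s,i}\,\bigl(P(g(\lambda^s)_i=1\mid y_1)-P(g(\lambda^s)_i=1\mid y_2)\bigr)\ge0$, and for $y_2$ (with $p'=1-p$) with sign $-\sigma_{s,i}$. Averaging over the two classes and summing over all pairs $i$ the estimated probabilities of $g(\lambda^s)_i\neq g(Y)_i$ gives an estimate $\hat m_s$ of $\mathbb E[d_\tau(\lambda^s,Y)]$. The estimate of $\theta_s$ is $\hat\theta_s=h_\rho^{-1}(\hat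 m_s)$. **Claim.** There is a constant $C>0$ depending only on $p$ such that, for all $\rho$, $y_1\neq y_2$, $n\ge1$, $\delta>0$, $U>0$, all parameters with $U>\theta_a,\theta_b,\theta_c>4\ln 2$ and all correct signs, writing $$\eta=C\binom{\rho}{2}\Bigl(\frac{\log(2\rho^2)}{2\delta n}\Bigr)^{1/4},$$ with probability at least $1-\delta$ the following holds for every $s\in\{a,b,c\}$: 1. if $\eta<h_\rho(\theta_s)$ (so that the right-hand side is defined), then $|\hat\theta_s-\theta_s|\le h_\rho^{-1}\bigl(h_\rho(\theta_s)-\eta\bigr)-\theta_s$; 2. if $2\eta\le h_\rho(U)$, then $|\hat\theta_s-\theta_s|\le \eta/|g_\rho(U)|$; in particular the error is of order $n^{-1/4}$. -/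

import Mathlib

open MeasureTheory ProbabilityTheory

namespace RankingWS

/-- A ranking of `ρ` items: `π i` is the position of item `i`. -/
abbrev Ranking (ρ : ℕ) : Type := Equiv.Perm (Fin ρ)

/-- Rankings form a finite set; every subset is measurable. -/
instance instMeasurableSpaceRanking (ρ : ℕ) : MeasurableSpace (Ranking ρ) := ⊤

/-- The `ρ.choose 2` pairs of items `(i, j)` with `i < j`. -/
abbrev ItemPair (ρ : ℕ) : Type := {e : Fin ρ × Fin ρ // e.1 < e.2}

/-- The Kendall tau distance: the number of pairs of items on which the rankings disagree. -/
def kendallTau {ρ : ℕ} (π σ : Ranking ρ) : ℕ :=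
  (Finset.univ.filter fun e : ItemPair ρ =>
    ¬ (π e.1.1 < π e.1.2 ↔ σ e.1.1 < σ e.1.2)).card

/-- The embedding of rankings into the hypercube `{±1} ^ (ρ.choose 2)`. -/
def embed {ρ : ℕ} (π : Ranking ρ) (e : ItemPair ρ) : ℤ :=
  if π e.1.1 < π e.1.2 then 1 else -1

noncomputable section

/-! ### The heterogeneous Mallows model -/

/-- Normalising constant of the Mallows law with centre `y`. -/
def mallowsZ {ρ : ℕ} (θ : ℝ) (y : Ranking ρ) : ℝ :=
  ∑ π : Ranking ρ, Real.exp (-θ * (kendallTau π y : ℝ))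

/-- Probability of `π` under the Mallows law with centre `y` and canonical parameter `θ`. -/
def mallowsProb {ρ : ℕ} (θ : ℝ) (y π : Ranking ρ) : ℝ :=
  Real.exp (-θ * (kendallTau π y : ℝ)) / mallowsZ θ y

/-- The probability that `g(λ)_e = 1` for `λ` with the Mallows law of centre `y`. -/
def coordProb {ρ : ℕ} (θ : ℝ) (y : Ranking ρ) (e : ItemPair ρ) : ℝ :=
  ∑ π : Ranking ρ, if embed π e = 1 then mallowsProb θ y π else 0

/-- The prior of the latent label: `y₁` with probability `p`, `y₂` with probability `1 - p`. -/
def binaryPrior {ρ : ℕ} (p : ℝ) (y₁ y₂ y : Ranking ρ) : ℝ :=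
  if y = y₁ then p else if y = y₂ then 1 - p else 0

/-- `(Y t, L t)`, `t < n`, are i.i.d.; each latent label `Y t` has the binary prior, and given
`Y t = y` the three outputs `L t 0`, `L t 1`, `L t 2` of the labeling functions are independent,
the `s`-th one with the Mallows law of centre `y` and parameter `θ s`. -/
structure IsTripletSample {Ω : Type*} [MeasurableSpace Ω] (μ : Measure Ω) {ρ n : ℕ} (p : ℝ)
    (y₁ y₂ : Ranking ρ) (θ : Fin 3 → ℝ) (Y : Fin n → Ω → Ranking ρ)
    (L : Fin n → Fin 3 → Ω → Ranking ρ) : Prop where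
  measurable_label : ∀ t, Measurable (Y t)
  measurable_output : ∀ t s, Measurable (L t s)
  indep : iIndepFun (fun (t : Fin n) (ω : Ω) => (Y t ω, fun s : Fin 3 => L t s ω)) μ
  law : ∀ (t : Fin n) (y : Ranking ρ) (l : Fin 3 → Ranking ρ),
    μ.real {ω | Y t ω = y ∧ ∀ s, L t s ω = l s} =
      binaryPrior p y₁ y₂ y * ∏ s, mallowsProb (θ s) y (l s)

/-! ### The mean map, its inverse, and its derivative -/

/-- `E_θ[D]`: the mean Kendall tau distance to the centre under the Mallows law. (It does not
depend on the centre, which is taken to be the identity.) -/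
def meanDist (ρ : ℕ) (θ : ℝ) : ℝ :=
  ∑ π : Ranking ρ, mallowsProb θ 1 π * (kendallTau π 1 : ℝ)

/-- The backward mapping: the canonical parameter `θ > 0` whose mean distance is `m`. -/
def backwardMap (ρ : ℕ) (m : ℝ) : ℝ :=
  Function.invFunOn (meanDist ρ) (Set.Ioi 0) m

/-- The function `g_ρ`, the closed form of the derivative of the mean map. -/
def gDeriv (ρ : ℕ) (U : ℝ) : ℝ :=
  -(ρ : ℝ) * Real.exp (-U) / (1 - Real.exp (-U)) ^ 2 +
    ∑ j ∈ Finset.Icc 1 ρ,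
      (j : ℝ) ^ 2 * Real.exp (-U * (j : ℝ)) / (1 - Real.exp (-U * (j : ℝ))) ^ 2

/-! ### The quadratic triplet algorithm -/

/-- Inputs `O_{a,b}, O_{a,c}, O_{b,c}, ℓ_a, ℓ_b, ℓ_c` of the triplet algorithm. -/
structure TripletObs where
  Oab : ℝ
  Oac : ℝ
  Obc : ℝ
  la : ℝ
  lb : ℝ
  lc : ℝ

/-- The accuracy of a second source with frequency `lb` and co-occurrence frequency `Oab`,
in terms of the accuracy `z` of the first source. -/
def partnerAccuracy (p Oab la lb z : ℝ) : ℝ :=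
  (Oab * (1 - p) - (la - p * z) * lb) / (p * z - p * la)

/-- The quadratic polynomial in `z`: with `β`, `γ` the partner accuracies belonging to `z`, it is
`(p β γ + ℓ_b ℓ_c - p β ℓ_c - p γ ℓ_b - O_{b,c} (1 - p)) (p z - p ℓ_a)²`, denominators cleared. -/
def tripletQuadratic (p : ℝ) (o : TripletObs) (z : ℝ) : ℝ :=
  p * (o.Oab * (1 - p) - (o.la - p * z) * o.lb) * (o.Oac * (1 - p) - (o.la - p * z) * o.lc)
    + (o.lb * o.lc - o.Obc * (1 - p)) * (p * z - p * o.la) ^ 2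
    - p * o.lc * (o.Oab * (1 - p) - (o.la - p * z) * o.lb) * (p * z - p * o.la)
    - p * o.lb * (o.Oac * (1 - p) - (o.la - p * z) * o.lc) * (p * z - p * o.la)

theorem tripletQuadratic_eq_mul (p : ℝ) (o : TripletObs) (z : ℝ) (hz : p * z - p * o.la ≠ 0) :
    tripletQuadratic p o z =
      (p * partnerAccuracy p o.Oab o.la o.lb z * partnerAccuracy p o.Oac o.la o.lc z
        + o.lb * o.lc - p * partnerAccuracy p o.Oab o.la o.lb z * o.lc
        - p * partnerAccuracy p o.Oac o.la o.lc z * o.lb - o.Obc * (1 - p))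
        * (p * z - p * o.la) ^ 2 := by
  unfold tripletQuadratic partnerAccuracy
  generalize p * z - p * o.la = D at hz ⊢
  field_simp
  ring

/-- The root of the quadratic on the side of `ℓ_a` given by the sign `σ`. If there is no real root
(or the equation degenerates), the value is the centre `ℓ_a` of the pair of roots. -/
def quadraticRoot (p : ℝ) (o : TripletObs) (σ : ℤˣ) : ℝ :=
  o.la + ((σ : ℤ) : ℝ) *
    Real.sqrt ((1 - p) / p *
      ((o.Oab - o.la * o.lb) * (o.Oac - o.la * o.lc) / (o.Obc - o.lb * o.lc)))

theorem tripletQuadratic_eq_zero_iff (p : ℝ) (hp0 : 0 < p) (hp1 : p < 1) (o : TripletObs)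
    (hbc : o.Obc - o.lb * o.lc ≠ 0)
    (hnn : 0 ≤ (o.Oab - o.la * o.lb) * (o.Oac - o.la * o.lc) / (o.Obc - o.lb * o.lc)) (z : ℝ) :
    tripletQuadratic p o z = 0 ↔ z = quadraticRoot p o 1 ∨ z = quadraticRoot p o (-1) := by
  have h1p : 0 < 1 - p := by linarith
  set R : ℝ := (o.Oab - o.la * o.lb) * (o.Oac - o.la * o.lc) / (o.Obc - o.lb * o.lc) with hR
  have hprod : (o.Oab - o.la * o.lb) * (o.Oac - o.la * o.lc) = R * (o.Obc - o.lb * o.lc) := by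
    rw [hR]; field_simp
  have hS : Real.sqrt ((1 - p) / p * R) ^ 2 = (1 - p) / p * R :=
    Real.sq_sqrt (mul_nonneg (div_nonneg h1p.le hp0.le) hnn)
  have key : tripletQuadratic p o z =
      -(1 - p) * p ^ 2 * (o.Obc - o.lb * o.lc) *
        ((z - o.la) ^ 2 - Real.sqrt ((1 - p) / p * R) ^ 2) := by
    have hT : tripletQuadratic p o z =
        p * (1 - p) ^ 2 * ((o.Oab - o.la * o.lb) * (o.Oac - o.la * o.lc))
          - (1 - p) * p ^ 2 * (o.Obc - o.lb * o.lc) * (z - o.la) ^ 2 := by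
      unfold tripletQuadratic; ring
    rw [hT, hprod, hS]
    field_simp
    ring
  have hc : -(1 - p) * p ^ 2 * (o.Obc - o.lb * o.lc) ≠ 0 := by
    have : p ≠ 0 := hp0.ne'
    have : -(1 - p) ≠ 0 := neg_ne_zero.mpr h1p.ne'
    positivity
  rw [key, mul_eq_zero, or_iff_right hc, sub_eq_zero, sq_eq_sq_iff_eq_or_eq_neg]
  simp only [quadraticRoot, ← hR, Units.val_one, Units.val_neg, Int.cast_one, Int.cast_neg]
  constructor
  · rintro (h | h)
    · left; linarith
    · right; linarith
  · rintro (h | h)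
    · left; linarith
    · right; linarith

/-- The triplet algorithm for one class of probability `p`: the estimates of
`P(g(λᵃ)_e = 1 | Y = y)`, `P(g(λᵇ)_e = 1 | Y = y)`, `P(g(λᶜ)_e = 1 | Y = y)`; `σ` is the recovered
sign of the first estimate relative to `ℓ_a`. -/
def quadraticTriplets (p : ℝ) (o : TripletObs) (σ : ℤˣ) : ℝ × ℝ × ℝ :=
  (quadraticRoot p o σ,
    partnerAccuracy p o.Oab o.la o.lb (quadraticRoot p o σ),
    partnerAccuracy p o.Oac o.la o.lc (quadraticRoot p o σ))

/-! ### The overall algorithm -/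

/-- The empirical frequency of `g(λˢ)_e = 1`. -/
def freq {ρ n : ℕ} (data : Fin n → Fin 3 → Ranking ρ) (s : Fin 3) (e : ItemPair ρ) : ℝ :=
  (∑ t : Fin n, if embed (data t s) e = 1 then (1 : ℝ) else 0) / n

/-- The empirical frequency of `g(λˢ)_e = 1` and `g(λʳ)_e = 1`. -/
def jointFreq {ρ n : ℕ} (data : Fin n → Fin 3 → Ranking ρ) (s r : Fin 3) (e : ItemPair ρ) : ℝ :=
  (∑ t : Fin n, if embed (data t s) e = 1 ∧ embed (data t r) e = 1 then (1 : ℝ) else 0) / n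

/-- The observables of the triplet in which source `s` comes first, followed by the other two. -/
def tripletObs {ρ n : ℕ} (data : Fin n → Fin 3 → Ranking ρ) (s : Fin 3) (e : ItemPair ρ) :
    TripletObs where
  Oab := jointFreq data s (s + 1) e
  Oac := jointFreq data s (s + 2) e
  Obc := jointFreq data (s + 1) (s + 2) e
  la := freq data s e
  lb := freq data (s + 1) e
  lc := freq data (s + 2) e

/-- Estimate of `P(g(λˢ)_e = 1 | Y = y₁)`. -/
def accuracy₁ {ρ n : ℕ} (p : ℝ) (σ : Fin 3 → ItemPair ρ → ℤˣ)
    (data : Fin n → Fin 3 → Ranking ρ) (s : Fin 3) (e : ItemPair ρ) : ℝ :=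
  (quadraticTriplets p (tripletObs data s e) (σ s e)).1

/-- Estimate of `P(g(λˢ)_e = 1 | Y = y₂)`. The marginal frequency lies between the two conditional
probabilities, so the sign is the opposite one. -/
def accuracy₂ {ρ n : ℕ} (p : ℝ) (σ : Fin 3 → ItemPair ρ → ℤˣ)
    (data : Fin n → Fin 3 → Ranking ρ) (s : Fin 3) (e : ItemPair ρ) : ℝ :=
  (quadraticTriplets (1 - p) (tripletObs data s e) (-σ s e)).1

/-- Estimated probability of disagreement with `y` on the pair `e`, if the probability of `+1`
is estimated by `α`. -/
def disagreement {ρ : ℕ} (y : Ranking ρ) (e : ItemPair ρ) (α : ℝ) : ℝ :=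
  if embed y e = 1 then 1 - α else α

/-- The estimate of the mean parameter `E[d_τ(λˢ, Y)]`. -/
def meanEstimate {ρ n : ℕ} (p : ℝ) (y₁ y₂ : Ranking ρ) (σ : Fin 3 → ItemPair ρ → ℤˣ)
    (data : Fin n → Fin 3 → Ranking ρ) (s : Fin 3) : ℝ :=
  ∑ e : ItemPair ρ, (p * disagreement y₁ e (accuracy₁ p σ data s e)
    + (1 - p) * disagreement y₂ e (accuracy₂ p σ data s e))

/-- The estimate of the canonical parameter `θ_s`: backward mapping applied to the estimated mean
parameter. -/
def thetaEstimate {ρ n : ℕ} (p : ℝ) (y₁ y₂ : Ranking ρ) (σ : Fin 3 → ItemPair ρ → ℤˣ)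
    (data : Fin n → Fin 3 → Ranking ρ) (s : Fin 3) : ℝ :=
  backwardMap ρ (meanEstimate p y₁ y₂ σ data s)

/-- The accuracy signs are recovered correctly: `σ s e` is a sign of
`P(g(λˢ)_e = 1 | Y = y₁) - P(g(λˢ)_e = 1 | Y = y₂)` (arbitrary if the difference vanishes). -/
def CorrectSigns {ρ : ℕ} (θ : Fin 3 → ℝ) (y₁ y₂ : Ranking ρ)
    (σ : Fin 3 → ItemPair ρ → ℤˣ) : Prop :=
  ∀ s e, 0 ≤ ((σ s e : ℤ) : ℝ) * (coordProb (θ s) y₁ e - coordProb (θ s) y₂ e)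

/-- The statistical rate `(log(2 ρ²) / (2 δ n)) ^ (1/4)`. -/
def rate (ρ n : ℕ) (δ : ℝ) : ℝ :=
  (Real.log (2 * (ρ : ℝ) ^ 2) / (2 * δ * (n : ℝ))) ^ (1 / 4 : ℝ)

end

end RankingWS

open RankingWS

namespace RankingWS

/-! ### Sums over pairs of items and the Kendall tau distance -/

/-! The mean Kendall distance is a sum over item pairs of disagreement probabilities
(`sum_disagreement_coordProb`), so each pair is estimated separately and the total is then inverted.

Weighted by the class probabilities, the two estimated accuracies of a pair are the weighted
frequency plus and minus one common square root. If `y₁` and `y₂` agree on the pair, the root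
cancels. If they differ, `θ > 4 log 2` gives `exp (-θ) ≤ 1/16`, so the two accuracies of every
source differ by at least 7/8: the covariances stay of order `p (1 - p)`, the radicand is bounded
away from zero, and the root is Lipschitz in the empirical frequencies (`abs_sqrt_cov_sub_le`,
`abs_pairEstimate_sub_le`). Hoeffding and a union bound control these frequencies up to `ε = 2 *
rate ^ 2`. The mean is thus estimated within a multiple of `rate ^ 2`, which is weakened to `rate`;
when `rate` is too large for this argument, `η` exceeds every possible mean and both claims are
vacuous.

For the inversion put `q = exp (-θ)`. Inserting the items one at a time writes the mean as a sum of
`ρ - 1` means of truncated geometric laws (`meanDist_succ`). Its slope in `q` is at least `(ρ - 1) /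
4` on `[0, 1/2]` and at most `4 (ρ - 1)` on `[0, 1/16]`. The constant `C` leaves a spare factor 128,
so these crude slopes suffice for both claims; no derivative of the mean map is computed. -/

theorem sum_prod_eq_two_mul_sum_itemPair {ρ : ℕ} (F : Fin ρ × Fin ρ → ℕ)
    (hdiag : ∀ a, F (a, a) = 0) (hsymm : ∀ a b, F (a, b) = F (b, a)) :
    ∑ x, F x = 2 * ∑ e : ItemPair ρ, F e.1 := by
  have hlt : ∑ e : ItemPair ρ, F e.1 =
      ∑ x ∈ Finset.univ.filter (fun x : Fin ρ × Fin ρ => x.1 < x.2), F x :=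
    (Finset.sum_subtype _ (by simp) F).symm
  have hgt : ∑ x ∈ Finset.univ.filter (fun x : Fin ρ × Fin ρ => x.2 < x.1), F x =
      ∑ x ∈ Finset.univ.filter (fun x : Fin ρ × Fin ρ => x.1 < x.2), F x :=
    Finset.sum_nbij' Prod.swap Prod.swap (by simp) (by simp) (by simp) (by simp)
      (fun x _ => hsymm x.1 x.2)
  rw [hlt, two_mul, ← Finset.sum_filter_add_sum_filter_not Finset.univ
    (fun x : Fin ρ × Fin ρ => x.1 < x.2) F]
  congr 1
  rw [← hgt]
  symm
  apply Finset.sum_subset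
  · intro x hx
    simp only [Finset.mem_filter, Finset.mem_univ, true_and] at hx ⊢
    exact not_lt.mpr hx.le
  · rintro ⟨a, b⟩ hx hx'
    simp only [Finset.mem_filter, Finset.mem_univ, true_and] at hx hx'
    obtain rfl : a = b := le_antisymm (not_lt.mp hx') (not_lt.mp hx)
    exact hdiag a

/-- The indicator that two rankings disagree on an ordered pair of items. -/
def discord {ρ : ℕ} (π σ : Ranking ρ) (x : Fin ρ × Fin ρ) : ℕ :=
  if π x.1 < π x.2 ↔ σ x.1 < σ x.2 then 0 else 1

theorem discord_self {ρ : ℕ} (π σ : Ranking ρ) (a : Fin ρ) : discord π σ (a, a) = 0 := by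
  simp [discord]

theorem discord_symm {ρ : ℕ} (π σ : Ranking ρ) (a b : Fin ρ) :
    discord π σ (a, b) = discord π σ (b, a) := by
  by_cases h : a = b
  · rw [h]
  have h1 : π a ≠ π b := fun h' => h (π.injective h')
  have h2 : σ a ≠ σ b := fun h' => h (σ.injective h')
  have h3 : (π a < π b ↔ ¬ π b < π a) := by
    rw [not_lt]; exact ⟨le_of_lt, fun h => lt_of_le_of_ne h h1⟩
  have h4 : (σ a < σ b ↔ ¬ σ b < σ a) := by
    rw [not_lt]; exact ⟨le_of_lt, fun h => lt_of_le_of_ne h h2⟩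
  simp only [discord, h3, h4, not_iff_not]

theorem kendallTau_eq_sum {ρ : ℕ} (π σ : Ranking ρ) :
    kendallTau π σ = ∑ e : ItemPair ρ, discord π σ e.1 := by
  rw [kendallTau, Finset.card_filter]
  exact Finset.sum_congr rfl fun e _ => by simp only [discord, ite_not]

/-- A permutation of the items acts on ordered pairs but does not preserve `ItemPair`, so
relabelling arguments use the doubled count. -/
theorem two_mul_kendallTau {ρ : ℕ} (π σ : Ranking ρ) :
    2 * kendallTau π σ = ∑ x, discord π σ x := by
  rw [kendallTau_eq_sum, sum_prod_eq_two_mul_sum_itemPair _ (discord_self π σ) (discord_symm π σ)]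

theorem card_itemPair (ρ : ℕ) : Fintype.card (ItemPair ρ) = ρ.choose 2 := by
  have h := sum_prod_eq_two_mul_sum_itemPair (ρ := ρ) (fun x => if x.1 = x.2 then 0 else 1)
    (by simp) (by intro a b; simp [eq_comm])
  have h1 : ∑ e : ItemPair ρ, (if e.1.1 = e.1.2 then 0 else 1) = Fintype.card (ItemPair ρ) := by
    rw [Finset.sum_congr rfl fun e _ => if_neg e.2.ne]; simp
  have h2 : ∑ x : Fin ρ × Fin ρ, (if x.1 = x.2 then 0 else 1) = ρ * (ρ - 1) := by
    rw [Fintype.sum_prod_type]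
    have : ∀ a : Fin ρ, ∑ b : Fin ρ, (if a = b then 0 else 1) = ρ - 1 := by
      intro a
      rw [Finset.sum_ite]
      simp [Finset.filter_ne]
    simp [this]
  rw [h1, h2] at h
  rw [Nat.choose_two_right, h]
  simp

theorem kendallTau_mul_right {ρ : ℕ} (π σ τ : Ranking ρ) :
    kendallTau (π * τ) (σ * τ) = kendallTau π σ := by
  have h : 2 * kendallTau (π * τ) (σ * τ) = 2 * kendallTau π σ := by
    rw [two_mul_kendallTau, two_mul_kendallTau]
    exact Fintype.sum_equiv (Equiv.prodCongr τ τ) _ _ fun x => rfl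
  omega

/-- Removing an inversion by exchanging two positions cannot create more discordances with a third
item than it removes. Adding to each ordered pair its image under the swap makes this visible term
by term, with a strict gain at `(i, j)`. -/
theorem kendallTau_mul_swap_lt {ρ : ℕ} (π σ : Ranking ρ) {i j : Fin ρ} (hπ : π j < π i)
    (hσ : σ i < σ j) : kendallTau (π * Equiv.swap i j) σ < kendallTau π σ := by
  set τ := Equiv.swap i j with hτ
  have hreindex : ∀ F : Fin ρ × Fin ρ → ℕ, ∑ x : Fin ρ × Fin ρ, F (τ x.1, τ x.2) = ∑ x, F x :=
    fun F => Fintype.sum_equiv (Equiv.prodCongr τ τ) _ _ fun x => rfl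
  have hij : i ≠ j := by rintro rfl; exact lt_irrefl _ hσ
  have key : ∑ x : Fin ρ × Fin ρ,
        (discord (π * τ) σ x + discord (π * τ) σ (τ x.1, τ x.2)) <
      ∑ x : Fin ρ × Fin ρ, (discord π σ x + discord π σ (τ x.1, τ x.2)) := by
    apply Finset.sum_lt_sum
    · rintro ⟨a, b⟩ -
      simp only [discord, Equiv.Perm.mul_apply, hτ, Equiv.swap_apply_self]
      by_cases hai : a = i <;> by_cases haj : a = j <;> by_cases hbi : b = i <;>
        by_cases hbj : b = j <;> try subst hai
      all_goals try subst haj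
      all_goals try subst hbi
      all_goals try subst hbj
      all_goals simp_all [Equiv.swap_apply_left, Equiv.swap_apply_right,
        Equiv.swap_apply_of_ne_of_ne]
      all_goals split_ifs <;> omega
    · refine ⟨(i, j), Finset.mem_univ _, ?_⟩
      simp [discord, hτ, hπ, hσ, hπ.le, hσ.le, not_lt.mpr]
  simp only [Finset.sum_add_distrib, hreindex, ← two_mul_kendallTau] at key
  omega

/-! ### Insertion of the first item -/

/-- The ranking of `n + 1` items in which the first item has position `k` and the other items are
ordered by `π`. -/
noncomputable def consRanking {n : ℕ} (k : Fin (n + 1)) (π : Ranking n) : Ranking (n + 1) :=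
  Equiv.ofBijective (Fin.cons k fun a => k.succAbove (π a) : Fin (n + 1) → Fin (n + 1)) <|
    Finite.injective_iff_bijective.mp <| Fin.cons_injective_iff.mpr
      ⟨by rintro ⟨a, ha⟩; exact Fin.succAbove_ne _ _ ha,
        Fin.succAbove_right_injective.comp π.injective⟩

@[simp] theorem consRanking_zero {n : ℕ} (k : Fin (n + 1)) (π : Ranking n) :
    consRanking k π 0 = k := rfl

@[simp] theorem consRanking_succ {n : ℕ} (k : Fin (n + 1)) (π : Ranking n) (a : Fin n) :
    consRanking k π a.succ = k.succAbove (π a) := rfl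

theorem consRanking_bijective (n : ℕ) :
    Function.Bijective fun x : Fin (n + 1) × Ranking n => consRanking x.1 x.2 := by
  rw [Fintype.bijective_iff_injective_and_card]
  constructor
  · rintro ⟨k, π⟩ ⟨l, σ⟩ h
    have hk : k = l := by simpa using congrArg (fun f : Ranking (n + 1) => f 0) h
    subst hk
    refine Prod.ext rfl (Equiv.ext fun a => ?_)
    have := congrArg (fun f : Ranking (n + 1) => f a.succ) h
    exact Fin.succAbove_right_injective (p := k) this
  · simp [Fintype.card_perm, Nat.factorial_succ]

/-- Exactly `k` items are placed before the first item, each a discordance with the identity; the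
relative order of the other items is that of `π`. -/
theorem kendallTau_consRanking {n : ℕ} (k : Fin (n + 1)) (π : Ranking n) :
    kendallTau (consRanking k π) 1 = k + kendallTau π 1 := by
  have h := two_mul_kendallTau (consRanking k π) 1
  have h0 : ∑ b : Fin n, discord (consRanking k π) 1 (0, b.succ) = k := by
    have : ∀ b : Fin n, discord (consRanking k π) 1 (0, b.succ) =
        (fun c : Fin n => if c.castSucc < k then 1 else 0) (π b) := by
      intro b
      simp only [discord, consRanking_zero, consRanking_succ, Equiv.Perm.one_apply,
        Fin.succ_pos, iff_true, Fin.lt_succAbove_iff_le_castSucc]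
      split_ifs <;> grind
    rw [Finset.sum_congr rfl fun b _ => this b, Equiv.sum_comp π (fun c : Fin n => if c.castSucc < k then 1 else 0), ← Finset.card_filter]
    have hk : ∀ c : Fin n, c.castSucc < k ↔ c.1 < k.1 := fun c => Iff.rfl
    simp only [hk]
    rw [Fin.card_filter_val_lt]
    omega
  have h1 : ∑ a : Fin n, discord (consRanking k π) 1 (a.succ, 0) = k := by
    rw [← h0]; exact Finset.sum_congr rfl fun b _ => discord_symm _ _ _ _
  have h2 : ∀ a b : Fin n, discord (consRanking k π) 1 (a.succ, b.succ) = discord π 1 (a, b) := by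
    intro a b
    exact if_congr (by simp) rfl rfl
  rw [Fintype.sum_prod_type, Fin.sum_univ_succ] at h
  simp only [Fin.sum_univ_succ (n := n), Finset.sum_add_distrib, h0, h1, h2, discord_self] at h
  have h3 := two_mul_kendallTau π 1
  rw [Fintype.sum_prod_type] at h3
  omega

theorem sum_ranking_succ {n : ℕ} (f : ℕ → ℝ) :
    ∑ π : Ranking (n + 1), f (kendallTau π 1) =
      ∑ k ∈ Finset.range (n + 1), ∑ π : Ranking n, f (k + kendallTau π 1) := by
  rw [← Fin.sum_univ_eq_sum_range (fun k => ∑ π : Ranking n, f (k + kendallTau π 1)),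
    ← Fintype.sum_prod_type', ← (consRanking_bijective n).sum_comp]
  exact Finset.sum_congr rfl fun x _ => by rw [kendallTau_consRanking]

/-! ### Truncated geometric laws -/

/-- The mean of the geometric law of ratio `q` conditioned on `{0, …, j - 1}`. -/
noncomputable def truncGeomMean (j : ℕ) (q : ℝ) : ℝ :=
  (∑ k ∈ Finset.range j, (k : ℝ) * q ^ k) / ∑ k ∈ Finset.range j, q ^ k

theorem one_le_geom_sum {j : ℕ} (hj : 1 ≤ j) {q : ℝ} (hq : 0 ≤ q) :
    1 ≤ ∑ k ∈ Finset.range j, q ^ k := by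
  obtain ⟨i, rfl⟩ := Nat.exists_eq_add_of_le' hj
  rw [Finset.sum_range_succ']
  have : 0 ≤ ∑ k ∈ Finset.range i, q ^ (k + 1) := Finset.sum_nonneg fun k _ => by positivity
  simp only [pow_zero]
  linarith

theorem geom_sum_mul_one_sub_le (j : ℕ) {q : ℝ} (hq : 0 ≤ q) :
    (∑ k ∈ Finset.range j, q ^ k) * (1 - q) ≤ 1 := by
  rw [geom_sum_mul_neg]
  have : 0 ≤ q ^ j := by positivity
  linarith

/-- The right side is the numerator of a difference of two values of `truncGeomMean`. It equals `q₂
- q₁` for two terms, and each further term adds a sum of nonnegative quantities. -/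
theorem sub_le_cross_geom_sum {q₁ q₂ : ℝ} (h1 : 0 ≤ q₁) (h12 : q₁ ≤ q₂) (i : ℕ) :
    q₂ - q₁ ≤
      (∑ k ∈ Finset.range (i + 2), (k : ℝ) * q₂ ^ k) * (∑ k ∈ Finset.range (i + 2), q₁ ^ k) -
      (∑ k ∈ Finset.range (i + 2), (k : ℝ) * q₁ ^ k) * (∑ k ∈ Finset.range (i + 2), q₂ ^ k) := by
  induction i with
  | zero =>
    apply le_of_eq
    simp only [Finset.sum_range_succ, Finset.sum_range_zero]
    push_cast
    ring
  | succ i ih =>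
    refine ih.trans ?_
    rw [← sub_nonneg]
    have key : 0 ≤ ∑ l ∈ Finset.range (i + 2), (((i + 2 : ℕ) : ℝ) - l) *
        (q₂ ^ (i + 2) * q₁ ^ l - q₁ ^ (i + 2) * q₂ ^ l) := by
      apply Finset.sum_nonneg
      intro l hl
      have hl' : l ≤ i + 2 := (Finset.mem_range.mp hl).le
      apply mul_nonneg
      · rw [sub_nonneg]; exact_mod_cast hl'
      · obtain ⟨d, hd⟩ := Nat.exists_eq_add_of_le hl'
        have h2 : 0 ≤ q₂ := h1.trans h12
        have : q₁ ^ d ≤ q₂ ^ d := pow_le_pow_left₀ h1 h12 d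
        rw [hd, pow_add, pow_add]
        have h3 : 0 ≤ q₁ ^ l * q₂ ^ l := by positivity
        nlinarith
    refine key.trans (le_of_eq ?_)
    have expand : ∑ l ∈ Finset.range (i + 2), (((i + 2 : ℕ) : ℝ) - l) *
        (q₂ ^ (i + 2) * q₁ ^ l - q₁ ^ (i + 2) * q₂ ^ l) =
        ((i + 2 : ℕ) : ℝ) * q₂ ^ (i + 2) * (∑ l ∈ Finset.range (i + 2), q₁ ^ l)
        - ((i + 2 : ℕ) : ℝ) * q₁ ^ (i + 2) * (∑ l ∈ Finset.range (i + 2), q₂ ^ l)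
        - q₂ ^ (i + 2) * (∑ l ∈ Finset.range (i + 2), (l : ℝ) * q₁ ^ l)
        + q₁ ^ (i + 2) * (∑ l ∈ Finset.range (i + 2), (l : ℝ) * q₂ ^ l) := by
      simp only [Finset.mul_sum]
      rw [← Finset.sum_sub_distrib, ← Finset.sum_sub_distrib, ← Finset.sum_add_distrib]
      exact Finset.sum_congr rfl fun l _ => by ring
    rw [expand, Finset.sum_range_succ _ (i + 2), Finset.sum_range_succ _ (i + 2),
      Finset.sum_range_succ _ (i + 2), Finset.sum_range_succ _ (i + 2)]
    ring

theorem le_truncGeomMean_sub {q₁ q₂ : ℝ} (h1 : 0 ≤ q₁) (h12 : q₁ ≤ q₂) (h2 : q₂ < 1) (i : ℕ) :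
    (q₂ - q₁) * ((1 - q₁) * (1 - q₂)) ≤ truncGeomMean (i + 2) q₂ - truncGeomMean (i + 2) q₁ := by
  have hS1 := one_le_geom_sum (j := i + 2) (by omega) h1
  have hS2 := one_le_geom_sum (j := i + 2) (by omega) (h1.trans h12)
  have hB1 := geom_sum_mul_one_sub_le (i + 2) h1
  have hB2 := geom_sum_mul_one_sub_le (i + 2) (h1.trans h12)
  have hD := sub_le_cross_geom_sum h1 h12 i
  unfold truncGeomMean
  set S₁ := ∑ k ∈ Finset.range (i + 2), q₁ ^ k
  set S₂ := ∑ k ∈ Finset.range (i + 2), q₂ ^ k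
  rw [div_sub_div _ _ (by positivity) (by positivity), le_div_iff₀ (by positivity)]
  calc (q₂ - q₁) * ((1 - q₁) * (1 - q₂)) * (S₂ * S₁)
      = (q₂ - q₁) * ((S₁ * (1 - q₁)) * (S₂ * (1 - q₂))) := by ring
    _ ≤ (q₂ - q₁) * (1 * 1) := by
        have h3 : 0 ≤ 1 - q₂ := by linarith
        have h4 : 0 ≤ q₂ - q₁ := by linarith
        gcongr
    _ ≤ _ := by linarith

theorem truncGeomMean_le {q : ℝ} (h0 : 0 ≤ q) (h1 : q < 1) {j : ℕ} (hj : 1 ≤ j) :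
    truncGeomMean j q ≤ q / (1 - q) ^ 2 := by
  have hN : ∑ k ∈ Finset.range j, (k : ℝ) * q ^ k ≤ q / (1 - q) ^ 2 :=
    sum_le_hasSum _ (fun k _ => by positivity)
      (hasSum_coe_mul_geometric_of_norm_lt_one (by rwa [Real.norm_of_nonneg h0]))
  exact (div_le_self (Finset.sum_nonneg fun k _ => by positivity)
    (one_le_geom_sum hj h0)).trans hN

/-- The mean value bound `k (1/16)^(k-1) (q₂ - q₁)`, written without the exponent `k - 1`. -/
theorem pow_sub_pow_le_of_le_sixteenth {q₁ q₂ : ℝ} (h1 : 0 ≤ q₁) (h12 : q₁ ≤ q₂)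
    (h2 : q₂ ≤ 1 / 16) (k : ℕ) : q₂ ^ k - q₁ ^ k ≤ 16 * k * (1 / 16) ^ k * (q₂ - q₁) := by
  induction k with
  | zero => simp
  | succ k ih =>
    have h3 : q₁ ^ k ≤ (1 / 16) ^ k := pow_le_pow_left₀ h1 (h12.trans h2) k
    have h4 : q₁ ^ k ≤ q₂ ^ k := pow_le_pow_left₀ h1 h12 k
    have h5 : q₂ * (q₂ ^ k - q₁ ^ k) ≤ 1 / 16 * (q₂ ^ k - q₁ ^ k) :=
      mul_le_mul_of_nonneg_right h2 (by linarith)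
    have h6 : q₁ ^ k * (q₂ - q₁) ≤ (1 / 16) ^ k * (q₂ - q₁) :=
      mul_le_mul_of_nonneg_right h3 (by linarith)
    push_cast
    calc q₂ ^ (k + 1) - q₁ ^ (k + 1) = q₂ * (q₂ ^ k - q₁ ^ k) + q₁ ^ k * (q₂ - q₁) := by ring
      _ ≤ 1 / 16 * (16 * k * (1 / 16) ^ k * (q₂ - q₁)) + (1 / 16) ^ k * (q₂ - q₁) := by linarith
      _ = _ := by ring

theorem eight_mul_sq_le_eight_pow (k : ℕ) : 8 * k ^ 2 ≤ 8 ^ k := by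
  rcases k with _ | k
  · simp
  induction k with
  | zero => simp
  | succ k ih =>
    calc 8 * (k + 1 + 1) ^ 2 ≤ 8 * (k + 1) ^ 2 * 8 := by nlinarith [Nat.zero_le k]
      _ ≤ 8 ^ (k + 1) * 8 := Nat.mul_le_mul_right 8 ih

/-- Replacing the larger denominator by the smaller one leaves a difference of numerators. Its terms
are at most `2 (1/2)^k (q₂ - q₁)`, and the geometric series sums to 4. -/
theorem truncGeomMean_sub_le {q₁ q₂ : ℝ} (h1 : 0 ≤ q₁) (h12 : q₁ ≤ q₂) (h2 : q₂ ≤ 1 / 16)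
    {j : ℕ} (hj : 1 ≤ j) : truncGeomMean j q₂ - truncGeomMean j q₁ ≤ 4 * (q₂ - q₁) := by
  have hq : 0 ≤ q₂ - q₁ := by linarith
  have hS1 := one_le_geom_sum hj h1
  have hS : ∑ k ∈ Finset.range j, q₁ ^ k ≤ ∑ k ∈ Finset.range j, q₂ ^ k :=
    Finset.sum_le_sum fun k _ => pow_le_pow_left₀ h1 h12 k
  have hN2 : 0 ≤ ∑ k ∈ Finset.range j, (k : ℝ) * q₂ ^ k :=
    Finset.sum_nonneg fun k _ => mul_nonneg k.cast_nonneg (pow_nonneg (h1.trans h12) k)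
  have hterm : ∀ k : ℕ, (k : ℝ) * q₂ ^ k - k * q₁ ^ k ≤ 2 * (1 / 2) ^ k * (q₂ - q₁) := by
    intro k
    have h3 := mul_le_mul_of_nonneg_left (pow_sub_pow_le_of_le_sixteenth h1 h12 h2 k)
      (k.cast_nonneg : (0 : ℝ) ≤ k)
    have h4 : (8 : ℝ) * k ^ 2 ≤ 8 ^ k := by exact_mod_cast eight_mul_sq_le_eight_pow k
    have h5 : (8 : ℝ) ^ k * (1 / 16) ^ k = (1 / 2) ^ k := by rw [← mul_pow]; norm_num
    have h6 : (k : ℝ) * (16 * k * (1 / 16) ^ k) ≤ 2 * (1 / 2) ^ k := by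
      rw [← h5]
      have : (0 : ℝ) ≤ (1 / 16) ^ k := by positivity
      nlinarith
    have h7 := mul_le_mul_of_nonneg_right h6 hq
    linarith
  have hN : (∑ k ∈ Finset.range j, (k : ℝ) * q₂ ^ k) - ∑ k ∈ Finset.range j, (k : ℝ) * q₁ ^ k ≤
      4 * (q₂ - q₁) := by
    rw [← Finset.sum_sub_distrib]
    calc _ ≤ ∑ k ∈ Finset.range j, 2 * (1 / 2 : ℝ) ^ k * (q₂ - q₁) :=
          Finset.sum_le_sum fun k _ => hterm k
      _ = 2 * ((∑ k ∈ Finset.range j, (1 / 2 : ℝ) ^ k) * (1 - 1 / 2)) * 2 * (q₂ - q₁) := by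
          rw [← Finset.sum_mul, ← Finset.mul_sum]; ring
      _ ≤ 2 * 1 * 2 * (q₂ - q₁) := by
          gcongr
          exact geom_sum_mul_one_sub_le j (by norm_num)
      _ = _ := by ring
  unfold truncGeomMean
  calc _ ≤ (∑ k ∈ Finset.range j, (k : ℝ) * q₂ ^ k) / (∑ k ∈ Finset.range j, q₁ ^ k) -
          (∑ k ∈ Finset.range j, (k : ℝ) * q₁ ^ k) / ∑ k ∈ Finset.range j, q₁ ^ k := by gcongr
    _ = ((∑ k ∈ Finset.range j, (k : ℝ) * q₂ ^ k) - ∑ k ∈ Finset.range j, (k : ℝ) * q₁ ^ k) /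
          ∑ k ∈ Finset.range j, q₁ ^ k := by rw [sub_div]
    _ ≤ 4 * (q₂ - q₁) / ∑ k ∈ Finset.range j, q₁ ^ k := by gcongr
    _ ≤ _ := div_le_self (by linarith) hS1

/-! ### The mean map as a function of `q = exp (-θ)` -/

/-- The mean distance under the Mallows law on rankings of `m + 1` items, as a function of
`q = exp (-θ)`. -/
noncomputable def meanPoly (m : ℕ) (q : ℝ) : ℝ := ∑ i ∈ Finset.range m, truncGeomMean (i + 2) q

theorem meanPoly_succ (m : ℕ) (q : ℝ) :
    meanPoly (m + 1) q = meanPoly m q + truncGeomMean (m + 2) q :=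
  Finset.sum_range_succ _ _

theorem meanPoly_zero_right (m : ℕ) : meanPoly m 0 = 0 := by
  refine Finset.sum_eq_zero fun i _ => ?_
  rw [truncGeomMean, Finset.sum_eq_zero, zero_div]
  intro k _
  rcases k with _ | k <;> simp

theorem sum_const_range (m : ℕ) (c : ℝ) : ∑ _i ∈ Finset.range m, c = m * c := by simp

theorem le_meanPoly_sub {q₁ q₂ : ℝ} (h1 : 0 ≤ q₁) (h12 : q₁ ≤ q₂) (h2 : q₂ < 1) (m : ℕ) :
    m * ((q₂ - q₁) * ((1 - q₁) * (1 - q₂))) ≤ meanPoly m q₂ - meanPoly m q₁ := by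
  rw [meanPoly, meanPoly, ← Finset.sum_sub_distrib, ← sum_const_range]
  exact Finset.sum_le_sum fun i _ => le_truncGeomMean_sub h1 h12 h2 i

theorem meanPoly_sub_le {q₁ q₂ : ℝ} (h1 : 0 ≤ q₁) (h12 : q₁ ≤ q₂) (h2 : q₂ ≤ 1 / 16) (m : ℕ) :
    meanPoly m q₂ - meanPoly m q₁ ≤ m * (4 * (q₂ - q₁)) := by
  rw [meanPoly, meanPoly, ← Finset.sum_sub_distrib, ← sum_const_range]
  exact Finset.sum_le_sum fun i _ => truncGeomMean_sub_le h1 h12 h2 (by omega)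

theorem meanPoly_le {q : ℝ} (h0 : 0 ≤ q) (h1 : q < 1) (m : ℕ) :
    meanPoly m q ≤ m * (q / (1 - q) ^ 2) := by
  rw [meanPoly, ← sum_const_range]
  exact Finset.sum_le_sum fun i _ => truncGeomMean_le h0 h1 (by omega)

theorem le_meanPoly {q : ℝ} (h0 : 0 ≤ q) (h1 : q < 1) (m : ℕ) :
    m * (q * (1 - q)) ≤ meanPoly m q := by
  simpa [meanPoly_zero_right] using le_meanPoly_sub le_rfl h0 h1 m

theorem meanPoly_strictMonoOn {m : ℕ} (hm : 1 ≤ m) : StrictMonoOn (meanPoly m) (Set.Ico 0 1) := by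
  intro a ha b hb hab
  have h := le_meanPoly_sub ha.1 hab.le hb.2 m
  have h1 : 0 < b - a := by linarith
  have h2 : 0 < 1 - a := by linarith [ha.2]
  have h3 : 0 < 1 - b := by linarith [hb.2]
  have h4 : (0 : ℝ) < m := by exact_mod_cast hm
  have : 0 < m * ((b - a) * ((1 - a) * (1 - b))) := by positivity
  linarith

theorem meanPoly_continuousOn (m : ℕ) : ContinuousOn (meanPoly m) (Set.Ici 0) := by
  unfold meanPoly truncGeomMean
  refine continuousOn_finsetSum _ fun i _ => ContinuousOn.div (by fun_prop) (by fun_prop) ?_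
  intro q hq
  linarith [one_le_geom_sum (j := i + 2) (by omega) hq]

/-- Under insertion of an item the weight `q ^ d` factors, so the distance is a sum of independent
truncated geometric variables and the means add up. -/
theorem sum_ranking_pow (m : ℕ) {q : ℝ} (hq : 0 ≤ q) :
    0 < ∑ π : Ranking (m + 1), q ^ kendallTau π 1 ∧
    ∑ π : Ranking (m + 1), (kendallTau π 1 : ℝ) * q ^ kendallTau π 1 =
      meanPoly m q * ∑ π : Ranking (m + 1), q ^ kendallTau π 1 := by
  induction m with
  | zero =>
    have h : ∀ π : Ranking (0 + 1), kendallTau π 1 = 0 := by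
      intro π
      have : Subsingleton (Fin (0 + 1)) := inferInstanceAs (Subsingleton (Fin 1))
      rw [show π = 1 from Equiv.ext fun a => Subsingleton.elim _ _]
      simp [kendallTau]
    simp [h, meanPoly]
  | succ m ih =>
    obtain ⟨hpos, ih⟩ := ih
    have hS := one_le_geom_sum (j := m + 2) (by omega) hq
    rw [sum_ranking_succ (fun d => q ^ d), sum_ranking_succ (fun d => (d : ℝ) * q ^ d)]
    set W := ∑ π : Ranking (m + 1), q ^ kendallTau π 1 with hW
    have hZ : ∑ k ∈ Finset.range (m + 1 + 1), ∑ π : Ranking (m + 1), q ^ (k + kendallTau π 1) =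
        (∑ k ∈ Finset.range (m + 2), q ^ k) * W := by
      rw [Finset.sum_mul]
      refine Finset.sum_congr rfl fun k _ => ?_
      rw [hW, Finset.mul_sum]
      exact Finset.sum_congr rfl fun π _ => by rw [pow_add]
    have hM : ∑ k ∈ Finset.range (m + 1 + 1), ∑ π : Ranking (m + 1),
          ((k + kendallTau π 1 : ℕ) : ℝ) * q ^ (k + kendallTau π 1) =
        (∑ k ∈ Finset.range (m + 2), (k : ℝ) * q ^ k) * W +
          (∑ k ∈ Finset.range (m + 2), q ^ k) * (meanPoly m q * W) := by
      rw [← ih, Finset.sum_mul, Finset.sum_mul, ← Finset.sum_add_distrib]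
      refine Finset.sum_congr rfl fun k _ => ?_
      rw [hW, Finset.mul_sum, Finset.mul_sum, ← Finset.sum_add_distrib]
      refine Finset.sum_congr rfl fun π _ => ?_
      rw [pow_add]; push_cast; ring
    rw [hZ, hM]
    refine ⟨by positivity, ?_⟩
    rw [meanPoly_succ, truncGeomMean]
    field_simp
    ring

theorem exp_neg_mul_natCast (θ : ℝ) (d : ℕ) : Real.exp (-θ * d) = Real.exp (-θ) ^ d := by
  rw [← Real.exp_nat_mul]; ring_nf

theorem meanDist_succ (m : ℕ) (θ : ℝ) :
    meanDist (m + 1) θ = meanPoly m (Real.exp (-θ)) := by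
  obtain ⟨hpos, h⟩ := sum_ranking_pow m (Real.exp_pos (-θ)).le
  simp only [meanDist, mallowsProb, mallowsZ, exp_neg_mul_natCast]
  rw [← mul_div_cancel_right₀ (meanPoly m (Real.exp (-θ))) hpos.ne', ← h, Finset.sum_div]
  exact Finset.sum_congr rfl fun π _ => by ring

/-! ### The backward mapping -/

theorem backwardMap_spec {m : ℕ} (hm : 1 ≤ m) {v : ℝ} (hv0 : 0 < v)
    (hv : v ≤ meanPoly m (1 / 2)) :
    Real.exp (-backwardMap (m + 1) v) ≤ 1 / 2 ∧
      meanPoly m (Real.exp (-backwardMap (m + 1) v)) = v := by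
  obtain ⟨q, ⟨hq0, hq1⟩, hq⟩ := intermediate_value_Icc (by norm_num : (0 : ℝ) ≤ 1 / 2)
    ((meanPoly_continuousOn m).mono Set.Icc_subset_Ici_self)
    ⟨by rw [meanPoly_zero_right]; exact hv0.le, hv⟩
  have hqpos : 0 < q := by
    refine lt_of_le_of_ne hq0 fun h => ?_
    rw [← h, meanPoly_zero_right] at hq
    exact hv0.ne hq
  have hex : ∃ θ ∈ Set.Ioi (0 : ℝ), meanDist (m + 1) θ = v := by
    refine ⟨-Real.log q, neg_pos.mpr (Real.log_neg hqpos (by linarith)), ?_⟩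
    rw [meanDist_succ, neg_neg, Real.exp_log hqpos, hq]
  have hmem : (0 : ℝ) < backwardMap (m + 1) v := Function.invFunOn_mem hex
  have heq : meanDist (m + 1) (backwardMap (m + 1) v) = v := Function.invFunOn_eq hex
  rw [meanDist_succ] at heq
  refine ⟨?_, heq⟩
  have : Real.exp (-backwardMap (m + 1) v) = q := by
    -- Injectivity on all of `[0, 1)` is needed: `invFunOn` only promises some positive parameter,
    -- not one with `q ≤ 1/2`.
    refine (meanPoly_strictMonoOn hm).injOn ⟨(Real.exp_pos _).le, ?_⟩ ⟨hq0, by linarith⟩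
      (heq.trans hq.symm)
    exact Real.exp_lt_one_iff.mpr (by linarith)
  rwa [this]

/-! ### The derivative of the mean map -/

/-- Arithmetic-geometric mean on terms symmetric about the middle. The recursion by two peels off
the outer terms through `1 + r^(2(i+3)) ≥ 2 r^(i+3)`. -/
theorem mul_pow_lt_geom_sum {r : ℝ} (h0 : 0 < r) (h1 : r < 1) :
    ∀ i : ℕ, ((i + 2 : ℕ) : ℝ) * r ^ (i + 1) < ∑ k ∈ Finset.range (i + 2), (r ^ 2) ^ k
  | 0 => by
    simp only [Finset.sum_range_succ, Finset.sum_range_zero]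
    push_cast
    nlinarith [sq_pos_of_pos (sub_pos.mpr h1)]
  | 1 => by
    simp only [Finset.sum_range_succ, Finset.sum_range_zero]
    push_cast
    have : 0 < 1 - r ^ 2 := by nlinarith
    nlinarith [sq_pos_of_pos this]
  | i + 2 => by
    have ih := mul_pow_lt_geom_sum h0 h1 i
    have hs : ∑ k ∈ Finset.range (i + 2 + 2), (r ^ 2) ^ k =
        1 + r ^ 2 * (∑ k ∈ Finset.range (i + 2), (r ^ 2) ^ k) + (r ^ (i + 3)) ^ 2 := by
      rw [Finset.sum_range_succ, Finset.sum_range_succ', Finset.mul_sum]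
      have : ∀ k, (r ^ 2) ^ (k + 1) = r ^ 2 * (r ^ 2) ^ k := fun k => by ring
      simp only [this]
      ring
    rw [hs]
    have h2 := mul_lt_mul_of_pos_left ih (by positivity : (0 : ℝ) < r ^ 2)
    push_cast at h2 ⊢
    have h3 : r ^ 2 * (((i : ℝ) + 2) * r ^ (i + 1)) = (i + 2) * r ^ (i + 3) := by ring
    have h4 : r ^ (i + 2 + 1) = r ^ (i + 3) := rfl
    rw [h4]
    nlinarith [sq_nonneg (1 - r ^ (i + 3))]

/-- The square of the previous inequality at `r = √q`; it gives every term of `gDeriv` beyond the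
first the same strict sign. -/
theorem sq_mul_pow_div_lt {q : ℝ} (h0 : 0 < q) (h1 : q < 1) (i : ℕ) :
    ((i + 2 : ℕ) : ℝ) ^ 2 * q ^ (i + 2) / (1 - q ^ (i + 2)) ^ 2 < q / (1 - q) ^ 2 := by
  have hr0 : 0 < Real.sqrt q := Real.sqrt_pos.mpr h0
  have hr1 : Real.sqrt q < 1 := by rw [Real.sqrt_lt' one_pos]; simpa using h1
  have hr2 : Real.sqrt q ^ 2 = q := Real.sq_sqrt h0.le
  have h := mul_pow_lt_geom_sum hr0 hr1 i
  rw [hr2] at h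
  have hsq : (((i + 2 : ℕ) : ℝ) * Real.sqrt q ^ (i + 1)) ^ 2 <
      (∑ k ∈ Finset.range (i + 2), q ^ k) ^ 2 := pow_lt_pow_left₀ h (by positivity) two_ne_zero
  rw [mul_pow, ← pow_mul, mul_comm (i + 1) 2, pow_mul, hr2] at hsq
  have h1q : 0 < 1 - q := by linarith
  have hpow : 0 < 1 - q ^ (i + 2) := by
    have := pow_lt_one₀ h0.le h1 (by omega : i + 2 ≠ 0)
    linarith
  rw [← geom_sum_mul_neg, mul_pow, div_lt_div_iff₀ _ (by positivity)]
  · calc _ = (((i + 2 : ℕ) : ℝ) ^ 2 * q ^ (i + 1)) * (q * (1 - q) ^ 2) := by ring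
      _ < (∑ k ∈ Finset.range (i + 2), q ^ k) ^ 2 * (q * (1 - q) ^ 2) := by gcongr
      _ = _ := by ring
  · rw [← mul_pow, geom_sum_mul_neg]; positivity

theorem sum_Icc_one_succ (F : ℕ → ℝ) (m : ℕ) :
    ∑ j ∈ Finset.Icc 1 (m + 1), F j = F 1 + ∑ i ∈ Finset.range m, F (i + 2) := by
  induction m with
  | zero => simp
  | succ m ih => rw [Finset.sum_Icc_succ_top (by omega), ih, Finset.sum_range_succ, add_assoc]

/-- The term `j = 1` cancels one of the `m + 1` copies of the leading fraction. -/
theorem gDeriv_succ (m : ℕ) (U : ℝ) :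
    gDeriv (m + 1) U = -∑ i ∈ Finset.range m,
      (Real.exp (-U) / (1 - Real.exp (-U)) ^ 2 - ((i + 2 : ℕ) : ℝ) ^ 2 * Real.exp (-U) ^ (i + 2) /
        (1 - Real.exp (-U) ^ (i + 2)) ^ 2) := by
  simp only [gDeriv, exp_neg_mul_natCast]
  rw [Finset.sum_sub_distrib, sum_const_range, sum_Icc_one_succ]
  push_cast
  ring

theorem abs_gDeriv_bounds {m : ℕ} (hm : 1 ≤ m) {U : ℝ} (hU : 0 < U) :
    0 < |gDeriv (m + 1) U| ∧
      |gDeriv (m + 1) U| ≤ m * (Real.exp (-U) / (1 - Real.exp (-U)) ^ 2) := by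
  have h0 := Real.exp_pos (-U)
  have h1 : Real.exp (-U) < 1 := Real.exp_lt_one_iff.mpr (by linarith)
  rw [gDeriv_succ, abs_neg]
  have hpos : 0 < ∑ i ∈ Finset.range m,
      (Real.exp (-U) / (1 - Real.exp (-U)) ^ 2 - ((i + 2 : ℕ) : ℝ) ^ 2 * Real.exp (-U) ^ (i + 2) /
        (1 - Real.exp (-U) ^ (i + 2)) ^ 2) :=
    Finset.sum_pos (fun i _ => sub_pos.mpr (sq_mul_pow_div_lt h0 h1 i))
      (by simpa using Nat.one_le_iff_ne_zero.mp hm)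
  rw [abs_of_pos hpos]
  refine ⟨hpos, ?_⟩
  rw [← sum_const_range]
  exact Finset.sum_le_sum fun i _ => sub_le_self _ (by positivity)

theorem abs_sub_mul_le_abs_exp_sub {a b c : ℝ} (ha : c ≤ Real.exp a) (hb : c ≤ Real.exp b) :
    |a - b| * c ≤ |Real.exp a - Real.exp b| := by
  wlog hab : a ≤ b generalizing a b
  · rw [abs_sub_comm a, abs_sub_comm (Real.exp a)]
    exact this hb ha (le_of_not_ge hab)
  rw [abs_sub_comm a, abs_sub_comm (Real.exp a), abs_of_nonneg (sub_nonneg.mpr hab),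
    abs_of_nonneg (sub_nonneg.mpr (Real.exp_le_exp.mpr hab))]
  have h1 : Real.exp b = Real.exp a * Real.exp (b - a) := by rw [← Real.exp_add]; ring_nf
  have h2 := Real.add_one_le_exp (b - a)
  have h3 := mul_le_mul_of_nonneg_left h2 (Real.exp_pos a).le
  have h4 := mul_le_mul_of_nonneg_left ha (sub_nonneg.mpr hab)
  rw [h1]
  linarith

theorem meanPoly_le_half {q : ℝ} (h0 : 0 ≤ q) (h1 : q ≤ 1 / 16) (m : ℕ) :
    2 * meanPoly m q ≤ meanPoly m (1 / 2) := by
  have h2 := le_meanPoly (q := 1 / 2) (by norm_num) (by norm_num) m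
  have h3 := meanPoly_le h0 (by linarith) m
  have h4 : q / (1 - q) ^ 2 ≤ (1 / 16) / (1 - 1 / 16) ^ 2 := by
    gcongr
  have h5 := mul_le_mul_of_nonneg_left h4 (m.cast_nonneg : (0 : ℝ) ≤ m)
  have h6 : (0 : ℝ) ≤ m := m.cast_nonneg
  norm_num at h2 h5
  linarith

theorem mul_sub_le_four_mul_meanPoly_sub {q₁ q₂ : ℝ} (h1 : 0 ≤ q₁) (h12 : q₁ ≤ q₂)
    (h2 : q₂ ≤ 1 / 2) (m : ℕ) : m * (q₂ - q₁) ≤ 4 * (meanPoly m q₂ - meanPoly m q₁) := by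
  have h := le_meanPoly_sub h1 h12 (by linarith) m
  have h3 : (1 / 2 : ℝ) * (1 / 2) ≤ (1 - q₁) * (1 - q₂) := by
    apply mul_le_mul <;> linarith
  have h4 : 0 ≤ m * (q₂ - q₁) := mul_nonneg m.cast_nonneg (by linarith)
  have h5 := mul_le_mul_of_nonneg_left h3 h4
  linarith

theorem mul_abs_sub_le_four_mul_abs_meanPoly_sub {q₁ q₂ : ℝ} (h1 : 0 ≤ q₁) (h1' : q₁ ≤ 1 / 2)
    (h2 : 0 ≤ q₂) (h2' : q₂ ≤ 1 / 2) (m : ℕ) :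
    m * |q₂ - q₁| ≤ 4 * |meanPoly m q₂ - meanPoly m q₁| := by
  rcases le_total q₁ q₂ with h | h
  · have := mul_sub_le_four_mul_meanPoly_sub h1 h h2' m
    rw [abs_of_nonneg (sub_nonneg.mpr h)]
    linarith [le_abs_self (meanPoly m q₂ - meanPoly m q₁)]
  · have := mul_sub_le_four_mul_meanPoly_sub h2 h h1' m
    rw [abs_of_nonpos (sub_nonpos.mpr h)]
    linarith [neg_le_abs (meanPoly m q₂ - meanPoly m q₁)]

/-- Such a `v` is positive and below twice the true mean, hence in the range of the mean map on `q ≤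
1/2` by `meanPoly_le_half`. -/
theorem backwardMap_spec_of_abs_sub_le {m : ℕ} (hm : 1 ≤ m) {θ v η : ℝ}
    (hθ : Real.exp (-θ) ≤ 1 / 16) (hη : η < meanDist (m + 1) θ)
    (hv : |v - meanDist (m + 1) θ| ≤ η) :
    Real.exp (-backwardMap (m + 1) v) ≤ 1 / 2 ∧
      meanPoly m (Real.exp (-backwardMap (m + 1) v)) = v := by
  rw [meanDist_succ] at hη hv
  have h := meanPoly_le_half (Real.exp_pos (-θ)).le hθ m
  obtain ⟨h1, h2⟩ := abs_le.mp hv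
  exact backwardMap_spec hm (by linarith) (by linarith)

/-- Overestimates of `θ` are handled by monotonicity. For underestimates the factor 128 absorbs the
ratio of the two slopes: the upward error in `q` is at most the downward shift caused by `η`. -/
theorem abs_backwardMap_sub_le_backwardMap_sub {m : ℕ} (hm : 1 ≤ m) {θ v η : ℝ}
    (hθ : Real.exp (-θ) ≤ 1 / 16) (hη : η < meanDist (m + 1) θ)
    (hv : |v - meanDist (m + 1) θ| ≤ η / 128) :
    |backwardMap (m + 1) v - θ| ≤ backwardMap (m + 1) (meanDist (m + 1) θ - η) - θ := by
  have hη0 : 0 ≤ η := by linarith [abs_nonneg (v - meanDist (m + 1) θ)]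
  obtain ⟨hq1, hqv⟩ := backwardMap_spec_of_abs_sub_le hm hθ hη (hv.trans (by linarith))
  obtain ⟨hr1, hrv⟩ := backwardMap_spec_of_abs_sub_le hm hθ hη
    (v := meanDist (m + 1) θ - η) (by rw [sub_sub_cancel_left, abs_neg, abs_of_nonneg hη0])
  set θv := backwardMap (m + 1) v
  set θr := backwardMap (m + 1) (meanDist (m + 1) θ - η)
  rw [meanDist_succ] at hη hv hrv
  have hmono := meanPoly_strictMonoOn hm
  have hq : Real.exp (-θ) ∈ Set.Ico (0 : ℝ) 1 := ⟨(Real.exp_pos _).le, by linarith⟩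
  have hqv' : Real.exp (-θv) ∈ Set.Ico (0 : ℝ) 1 := ⟨(Real.exp_pos _).le, by linarith⟩
  have hqr' : Real.exp (-θr) ∈ Set.Ico (0 : ℝ) 1 := ⟨(Real.exp_pos _).le, by linarith⟩
  obtain ⟨hv1, hv2⟩ := abs_le.mp hv
  have hrv_le : Real.exp (-θr) ≤ Real.exp (-θv) := by
    rw [← hmono.le_iff_le hqr' hqv', hrv, hqv]; linarith
  have hr_le : Real.exp (-θr) ≤ Real.exp (-θ) := by
    rw [← hmono.le_iff_le hqr' hq, hrv]; linarith
  rw [Real.exp_le_exp] at hrv_le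
  rcases le_total θ θv with h | h
  · rw [abs_of_nonneg (by linarith)]; linarith
  · have hle : Real.exp (-θ) ≤ Real.exp (-θv) := Real.exp_le_exp.mpr (by linarith)
    have h1 := mul_sub_le_four_mul_meanPoly_sub hq.1 hle hq1 m
    have h2 := meanPoly_sub_le hqr'.1 hr_le hθ m
    rw [hqv] at h1
    rw [hrv] at h2
    have hm' : (0 : ℝ) < m := by exact_mod_cast hm
    have h3 : m * (Real.exp (-θv) - Real.exp (-θ)) ≤ m * (Real.exp (-θ) - Real.exp (-θr)) := by
      linarith
    have h4 := le_of_mul_le_mul_left h3 hm'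
    -- By `h4` the arithmetic mean of the two outer values is at most the middle one, hence so is
    -- their geometric mean. Taking logarithms gives `θ - θv ≤ θr - θ`.
    have h5 : Real.exp (-θv) * Real.exp (-θr) ≤ Real.exp (-θ) * Real.exp (-θ) := by
      nlinarith [sq_nonneg (Real.exp (-θ) - Real.exp (-θr)), Real.exp_pos (-θr)]
    rw [← Real.exp_add, ← Real.exp_add, Real.exp_le_exp] at h5
    rw [abs_of_nonpos (by linarith)]
    linarith

theorem abs_backwardMap_sub_le_div_gDeriv {m : ℕ} (hm : 1 ≤ m) {θ U v η : ℝ}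
    (hθ : Real.exp (-θ) ≤ 1 / 16) (hθU : θ ≤ U) (hU : 0 < U) (hη : 2 * η ≤ meanDist (m + 1) U)
    (hv : |v - meanDist (m + 1) θ| ≤ η / 128) :
    |backwardMap (m + 1) v - θ| ≤ η / |gDeriv (m + 1) U| := by
  have hη0 : 0 ≤ η := by linarith [abs_nonneg (v - meanDist (m + 1) θ)]
  have hm' : (0 : ℝ) < m := by exact_mod_cast hm
  have hUθ : Real.exp (-U) ≤ Real.exp (-θ) := Real.exp_le_exp.mpr (by linarith)
  have hU0 := Real.exp_pos (-U)
  have hGU := le_meanPoly hU0.le (by linarith) m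
  have hGU' : (m : ℝ) * Real.exp (-U) ≤ 2 * meanPoly m (Real.exp (-U)) := by
    have : 0 < m * Real.exp (-U) := by positivity
    nlinarith
  have hGθ : meanPoly m (Real.exp (-U)) ≤ meanPoly m (Real.exp (-θ)) :=
    (meanPoly_strictMonoOn hm).monotoneOn ⟨hU0.le, by linarith⟩
      ⟨(Real.exp_pos _).le, by linarith⟩ hUθ
  have hGU0 : 0 < meanPoly m (Real.exp (-U)) := by
    have : 0 < m * Real.exp (-U) := by positivity
    linarith
  rw [meanDist_succ] at hη
  obtain ⟨hq1, hqv⟩ := backwardMap_spec_of_abs_sub_le hm hθ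
    (by rw [meanDist_succ]; linarith) (hv.trans (by linarith : η / 128 ≤ η))
  set θv := backwardMap (m + 1) v
  rw [meanDist_succ] at hv
  obtain ⟨hv1, hv2⟩ := abs_le.mp hv
  have hqv0 := Real.exp_pos (-θv)
  -- The condition `2 * η ≤ meanDist (m + 1) U` keeps `v` from being too small, so `θv` exceeds `U`
  -- by at most `log 16` and differences of `q` control differences of `θ`.
  have hlow : Real.exp (-U) / 16 ≤ Real.exp (-θv) := by
    have h1 := meanPoly_le hqv0.le (by linarith) m
    have h2 : Real.exp (-θv) / (1 - Real.exp (-θv)) ^ 2 ≤ Real.exp (-θv) / (1 / 2) ^ 2 := by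
      gcongr
      linarith
    have h3 := mul_le_mul_of_nonneg_left h2 hm'.le
    rw [hqv] at h1
    have h4 : m * (Real.exp (-U) / 16) ≤ m * Real.exp (-θv) := by
      norm_num at h3
      linarith
    exact le_of_mul_le_mul_left h4 hm'
  have hexp := abs_sub_mul_le_abs_exp_sub hlow (by linarith : Real.exp (-U) / 16 ≤ Real.exp (-θ))
  have hG := mul_abs_sub_le_four_mul_abs_meanPoly_sub (Real.exp_pos (-θ)).le (by linarith)
    hqv0.le hq1 m
  rw [hqv] at hG
  rw [neg_sub_neg, abs_sub_comm] at hexp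
  obtain ⟨hg0, hg⟩ := abs_gDeriv_bounds hm hU
  have hg' : |gDeriv (m + 1) U| ≤ m * (Real.exp (-U) / (3 / 4) ^ 2) := by
    refine hg.trans ?_
    gcongr
    linarith
  rw [le_div_iff₀ hg0]
  calc |θv - θ| * |gDeriv (m + 1) U| ≤ |θv - θ| * (m * (Real.exp (-U) / (3 / 4) ^ 2)) := by gcongr
    _ = 256 / 9 * (m * (|θv - θ| * (Real.exp (-U) / 16))) := by ring
    _ ≤ 256 / 9 * (m * |Real.exp (-θv) - Real.exp (-θ)|) := by gcongr
    _ ≤ η := by linarith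

instance instDiscreteMeasurableSpaceRanking (ρ : ℕ) : DiscreteMeasurableSpace (Ranking ρ) :=
  ⟨fun _ => trivial⟩

/-! ### The Mallows law -/

theorem mallowsZ_pos {ρ : ℕ} (θ : ℝ) (y : Ranking ρ) : 0 < mallowsZ θ y :=
  Finset.sum_pos (fun _ _ => Real.exp_pos _) Finset.univ_nonempty

theorem mallowsProb_nonneg {ρ : ℕ} (θ : ℝ) (y π : Ranking ρ) : 0 ≤ mallowsProb θ y π :=
  div_nonneg (Real.exp_pos _).le (mallowsZ_pos θ y).le

theorem sum_mallowsProb {ρ : ℕ} (θ : ℝ) (y : Ranking ρ) : ∑ π, mallowsProb θ y π = 1 := by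
  simp only [mallowsProb]
  rw [← Finset.sum_div, ← mallowsZ, div_self (mallowsZ_pos θ y).ne']

theorem sum_mallowsProb_mul_kendallTau {ρ : ℕ} (θ : ℝ) (y : Ranking ρ) :
    ∑ π, mallowsProb θ y π * (kendallTau π y : ℝ) = meanDist ρ θ := by
  have hk : ∀ π : Ranking ρ, kendallTau (π * y) y = kendallTau π 1 := by
    intro π
    simpa using kendallTau_mul_right π 1 y
  have hZ : mallowsZ θ y = mallowsZ θ (1 : Ranking ρ) := by
    rw [mallowsZ, mallowsZ, ← Equiv.sum_comp (Equiv.mulRight y)]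
    simp [hk]
  rw [meanDist, ← Equiv.sum_comp (Equiv.mulRight y)]
  simp [mallowsProb, hk, hZ]

/-- Swapping the inverted pair is injective and lowers the distance by at least one, so it raises
the weight by a factor at least `exp θ`; the images have total mass at most 1. -/
theorem sum_mallowsProb_reversed_le {ρ : ℕ} {θ : ℝ} (hθ : 0 ≤ θ) (y : Ranking ρ) {a b : Fin ρ}
    (hy : y a < y b) :
    ∑ π : Ranking ρ, (if π b < π a then mallowsProb θ y π else 0) ≤ Real.exp (-θ) := by
  calc ∑ π : Ranking ρ, (if π b < π a then mallowsProb θ y π else 0)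
      ≤ ∑ π : Ranking ρ, Real.exp (-θ) * mallowsProb θ y (π * Equiv.swap a b) := by
        refine Finset.sum_le_sum fun π _ => ?_
        split_ifs with hπ
        · have hlt := kendallTau_mul_swap_lt π y hπ hy
          have hlt' : (kendallTau (π * Equiv.swap a b) y : ℝ) + 1 ≤ kendallTau π y := by
            exact_mod_cast hlt
          rw [mallowsProb, mallowsProb, ← mul_div_assoc, ← Real.exp_add]
          refine div_le_div_of_nonneg_right (Real.exp_le_exp.mpr ?_) (mallowsZ_pos θ y).le
          nlinarith
        · exact mul_nonneg (Real.exp_pos _).le (mallowsProb_nonneg _ _ _)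
    _ = Real.exp (-θ) := by
        have h := Equiv.sum_comp (Equiv.mulRight (Equiv.swap a b)) (mallowsProb θ y)
        rw [sum_mallowsProb] at h
        rw [← Finset.mul_sum]
        exact (congrArg _ h).trans (mul_one _)

theorem coordProb_nonneg {ρ : ℕ} (θ : ℝ) (y : Ranking ρ) (e : ItemPair ρ) :
    0 ≤ coordProb θ y e :=
  Finset.sum_nonneg fun π _ => by split_ifs <;> first | exact mallowsProb_nonneg _ _ _ | rfl

theorem one_sub_coordProb {ρ : ℕ} (θ : ℝ) (y : Ranking ρ) (e : ItemPair ρ) :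
    1 - coordProb θ y e = ∑ π, if embed π e = 1 then 0 else mallowsProb θ y π := by
  rw [← sum_mallowsProb θ y, coordProb, ← Finset.sum_sub_distrib]
  exact Finset.sum_congr rfl fun π _ => by split_ifs <;> simp

theorem coordProb_le_one {ρ : ℕ} (θ : ℝ) (y : Ranking ρ) (e : ItemPair ρ) :
    coordProb θ y e ≤ 1 := by
  rw [← sub_nonneg, one_sub_coordProb]
  exact Finset.sum_nonneg fun π _ => by split_ifs <;> first | exact mallowsProb_nonneg _ _ _ | rfl

theorem embed_eq_one_iff {ρ : ℕ} (π : Ranking ρ) (e : ItemPair ρ) :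
    embed π e = 1 ↔ π e.1.1 < π e.1.2 := by
  unfold embed; split_ifs with h <;> simp [h]

theorem embed_ne_one_iff {ρ : ℕ} (π : Ranking ρ) (e : ItemPair ρ) :
    embed π e ≠ 1 ↔ π e.1.2 < π e.1.1 := by
  rw [Ne, embed_eq_one_iff, not_lt, le_iff_lt_or_eq, or_iff_left]
  exact fun h => e.2.ne' (π.injective h)

theorem one_sub_exp_le_coordProb {ρ : ℕ} {θ : ℝ} (hθ : 0 ≤ θ) {y : Ranking ρ} {e : ItemPair ρ}
    (hy : embed y e = 1) : 1 - Real.exp (-θ) ≤ coordProb θ y e := by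
  have h := sum_mallowsProb_reversed_le hθ y ((embed_eq_one_iff y e).mp hy)
  simp only [← embed_ne_one_iff, ite_not] at h
  rw [← one_sub_coordProb] at h
  linarith

theorem coordProb_le_exp {ρ : ℕ} {θ : ℝ} (hθ : 0 ≤ θ) {y : Ranking ρ} {e : ItemPair ρ}
    (hy : embed y e ≠ 1) : coordProb θ y e ≤ Real.exp (-θ) := by
  have h := sum_mallowsProb_reversed_le hθ y ((embed_ne_one_iff y e).mp hy)
  simp only [← embed_eq_one_iff] at h
  exact h

theorem sum_disagreement_coordProb {ρ : ℕ} (θ : ℝ) (y : Ranking ρ) :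
    ∑ e : ItemPair ρ, disagreement y e (coordProb θ y e) = meanDist ρ θ := by
  rw [← sum_mallowsProb_mul_kendallTau θ y]
  have h1 : ∀ e : ItemPair ρ, disagreement y e (coordProb θ y e) =
      ∑ π, mallowsProb θ y π * (discord π y e.1 : ℝ) := by
    intro e
    unfold disagreement
    split_ifs with hy
    · rw [one_sub_coordProb]
      rw [embed_eq_one_iff] at hy
      refine Finset.sum_congr rfl fun π _ => ?_
      simp only [embed_eq_one_iff, discord, hy, iff_true]
      split_ifs <;> simp
    · rw [coordProb]
      rw [embed_eq_one_iff] at hy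
      refine Finset.sum_congr rfl fun π _ => ?_
      simp only [embed_eq_one_iff, discord, hy, iff_false]
      split_ifs <;> simp
  rw [Finset.sum_congr rfl fun e _ => h1 e, Finset.sum_comm]
  refine Finset.sum_congr rfl fun π _ => ?_
  rw [← Finset.mul_sum, kendallTau_eq_sum]
  push_cast
  rfl

theorem disagreement_le_one {ρ : ℕ} (y : Ranking ρ) (e : ItemPair ρ) {α : ℝ} (h0 : 0 ≤ α)
    (h1 : α ≤ 1) : disagreement y e α ≤ 1 := by
  unfold disagreement; split_ifs <;> linarith

theorem meanDist_le_choose (ρ : ℕ) (θ : ℝ) : meanDist ρ θ ≤ ρ.choose 2 := by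
  rw [← sum_disagreement_coordProb θ 1, ← card_itemPair, Fintype.card_eq_sum_ones]
  push_cast
  exact Finset.sum_le_sum fun e _ =>
    disagreement_le_one _ _ (coordProb_nonneg _ _ _) (coordProb_le_one _ _ _)

/-! ### The law of a sample -/

theorem sum_binaryPrior_mul {ρ : ℕ} (p : ℝ) {y₁ y₂ : Ranking ρ} (hy : y₁ ≠ y₂)
    (F : Ranking ρ → ℝ) :
    ∑ y, binaryPrior p y₁ y₂ y * F y = p * F y₁ + (1 - p) * F y₂ := by
  have h : ∀ y, binaryPrior p y₁ y₂ y * F y =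
      (if y = y₁ then p * F y₁ else 0) + if y = y₂ then (1 - p) * F y₂ else 0 := by
    intro y
    unfold binaryPrior
    by_cases h1 : y = y₁
    · subst h1; simp [hy]
    · by_cases h2 : y = y₂
      · subst h2; simp [h1]
      · simp [h1, h2]
  simp only [h, Finset.sum_add_distrib, Finset.sum_ite_eq', Finset.mem_univ, if_true]

/-- The probability of `g(λˢ)_e = 1` and `g(λʳ)_e = 1`. -/
noncomputable def jointProb {ρ : ℕ} (p : ℝ) (y₁ y₂ : Ranking ρ) (θ : Fin 3 → ℝ) (s r : Fin 3)
    (e : ItemPair ρ) : ℝ :=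
  p * (∏ u, if u = s ∨ u = r then coordProb (θ u) y₁ e else 1) +
    (1 - p) * ∏ u, if u = s ∨ u = r then coordProb (θ u) y₂ e else 1

section Sample

variable {Ω : Type*} [MeasurableSpace Ω] {μ : Measure Ω} {ρ n : ℕ} {p : ℝ}
  {y₁ y₂ : Ranking ρ} {θ : Fin 3 → ℝ} {Y : Fin n → Ω → Ranking ρ}
  {L : Fin n → Fin 3 → Ω → Ranking ρ}

theorem IsTripletSample.measureReal_forall_mem [IsProbabilityMeasure μ]
    (h : IsTripletSample μ p y₁ y₂ θ Y L) (t : Fin n) (A : Fin 3 → Finset (Ranking ρ)) :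
    μ.real {ω | ∀ s, L t s ω ∈ A s} =
      ∑ y, binaryPrior p y₁ y₂ y * ∏ s, ∑ π ∈ A s, mallowsProb (θ s) y π := by
  have hset : {ω | ∀ s, L t s ω ∈ A s} =
      ⋃ x ∈ (Finset.univ : Finset (Ranking ρ)) ×ˢ Fintype.piFinset A,
        {ω | Y t ω = x.1 ∧ ∀ s, L t s ω = x.2 s} := by
    ext ω
    simp only [Set.mem_ofPred_eq, Set.mem_iUnion, Finset.mem_product, Finset.mem_univ, true_and,
      Fintype.mem_piFinset, exists_prop]
    constructor
    · intro hω
      exact ⟨(Y t ω, fun s => L t s ω), hω, rfl, fun s => rfl⟩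
    · rintro ⟨x, hx, -, hL⟩ s
      rw [hL s]; exact hx s
  rw [hset, measureReal_biUnion_finset]
  · rw [Finset.sum_product]
    refine Finset.sum_congr rfl fun y _ => ?_
    rw [Finset.prod_univ_sum, Finset.mul_sum]
    exact Finset.sum_congr rfl fun l _ => h.law t y l
  · rintro ⟨y, l⟩ - ⟨y', l'⟩ - hne
    refine Set.disjoint_left.mpr ?_
    rintro ω ⟨hY, hL⟩ ⟨hY', hL'⟩
    exact hne (Prod.ext (hY.symm.trans hY') (funext fun s => (hL s).symm.trans (hL' s)))
  · rintro ⟨y, l⟩ -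
    have hpre : {ω | Y t ω = y ∧ ∀ s, L t s ω = l s} =
        Y t ⁻¹' {y} ∩ ⋂ s, L t s ⁻¹' {l s} := by
      ext ω
      simp
    rw [hpre]
    exact (h.measurable_label t (measurableSet_singleton y)).inter
      (MeasurableSet.iInter fun s => h.measurable_output t s (measurableSet_singleton (l s)))

theorem IsTripletSample.measureReal_embed_eq_one [IsProbabilityMeasure μ]
    (h : IsTripletSample μ p y₁ y₂ θ Y L) (hy : y₁ ≠ y₂) (t : Fin n) (s r : Fin 3)
    (e : ItemPair ρ) :
    μ.real {ω | embed (L t s ω) e = 1 ∧ embed (L t r ω) e = 1} = jointProb p y₁ y₂ θ s r e := by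
  have hset : {ω | embed (L t s ω) e = 1 ∧ embed (L t r ω) e = 1} =
      {ω | ∀ u, L t u ω ∈ (if u = s ∨ u = r then
        Finset.univ.filter fun π : Ranking ρ => embed π e = 1 else Finset.univ)} := by
    ext ω
    simp only [Set.mem_ofPred_eq]
    constructor
    · rintro ⟨hs, hr⟩ u
      split_ifs with hu
      · rcases hu with rfl | rfl <;> simpa
      · simp
    · intro hω
      have hs := hω s
      have hr := hω r
      simp at hs hr
      exact ⟨hs, hr⟩
  have hsum : ∀ (u : Fin 3) (y : Ranking ρ), ∑ π ∈ (if u = s ∨ u = r then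
        Finset.univ.filter fun π : Ranking ρ => embed π e = 1 else Finset.univ),
        mallowsProb (θ u) y π = if u = s ∨ u = r then coordProb (θ u) y e else 1 := by
    intro u y
    split_ifs
    · rw [Finset.sum_filter, coordProb]
    · exact sum_mallowsProb _ _
  rw [hset, h.measureReal_forall_mem]
  simp only [hsum]
  rw [sum_binaryPrior_mul p hy, jointProb]

end Sample

/-! ### Concentration of the empirical frequencies -/

theorem measureReal_mean_sub_ge_le {Ω : Type*} [MeasurableSpace Ω] {μ : Measure Ω}
    [IsProbabilityMeasure μ] {n : ℕ} (hn : 0 < n) {X : Fin n → Ω → ℝ} {m ε : ℝ}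
    (hmeas : ∀ t, Measurable (X t)) (hindep : iIndepFun X μ)
    (hX : ∀ t ω, X t ω ∈ Set.Icc (0 : ℝ) 1) (hm : ∀ t, ∫ ω, X t ω ∂μ = m) (hε : 0 ≤ ε) :
    μ.real {ω | ε ≤ (∑ t, X t ω) / n - m} ≤ Real.exp (-(2 * n * ε ^ 2)) := by
  have hn' : (0 : ℝ) < n := by exact_mod_cast hn
  have hind : iIndepFun (fun t ω => X t ω - m) μ :=
    hindep.comp (fun _ x => x - m) fun _ => by fun_prop
  -- The variance proxy is the squared half-length of `[0, 1]`.
  have hsub : ∀ t ∈ Finset.univ, HasSubgaussianMGF (fun ω => X t ω - m) (1 / 4) μ := by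
    intro t _
    have := hasSubgaussianMGF_of_mem_Icc (hmeas t).aemeasurable (ae_of_all μ (hX t))
    rw [hm t] at this
    convert this using 1
    ext; norm_num
  have h := HasSubgaussianMGF.measure_sum_ge_le_of_iIndepFun hind hsub
    (ε := n * ε) (by positivity)
  have hset : {ω | ε ≤ (∑ t, X t ω) / n - m} = {ω | n * ε ≤ ∑ t, (X t ω - m)} := by
    ext ω
    simp only [Set.mem_ofPred_eq, Finset.sum_sub_distrib, Finset.sum_const, Finset.card_univ,
      Fintype.card_fin, nsmul_eq_mul]
    rw [← mul_le_mul_iff_right₀ hn', mul_sub, mul_div_cancel₀ _ hn'.ne']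
  rw [hset]
  refine h.trans (le_of_eq ?_)
  simp only [Finset.sum_const, Finset.card_univ, Fintype.card_fin, nsmul_eq_mul]
  push_cast
  congr 1
  field_simp
  ring

theorem measureReal_abs_mean_sub_ge_le {Ω : Type*} [MeasurableSpace Ω] {μ : Measure Ω}
    [IsProbabilityMeasure μ] {n : ℕ} (hn : 0 < n) {X : Fin n → Ω → ℝ} {m ε : ℝ}
    (hmeas : ∀ t, Measurable (X t)) (hindep : iIndepFun X μ)
    (hX : ∀ t ω, X t ω ∈ Set.Icc (0 : ℝ) 1) (hm : ∀ t, ∫ ω, X t ω ∂μ = m) (hε : 0 ≤ ε) :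
    μ.real {ω | ε ≤ |(∑ t, X t ω) / n - m|} ≤ 2 * Real.exp (-(2 * n * ε ^ 2)) := by
  have hn' : (0 : ℝ) < n := by exact_mod_cast hn
  have h1 := measureReal_mean_sub_ge_le hn hmeas hindep hX hm hε
  have h2 := measureReal_mean_sub_ge_le (X := fun t ω => 1 - X t ω) (m := 1 - m) hn
    (fun t => (hmeas t).const_sub 1) (hindep.comp (fun _ x => 1 - x) fun _ => by fun_prop)
    (fun t ω => ⟨by linarith [(hX t ω).2], by linarith [(hX t ω).1]⟩)
    (fun t => by
      rw [integral_sub (integrable_const _)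
        (Integrable.of_mem_Icc 0 1 (hmeas t).aemeasurable (ae_of_all μ (hX t))), hm t]
      simp) hε
  have hset : {ω | ε ≤ |(∑ t, X t ω) / n - m|} ⊆
      {ω | ε ≤ (∑ t, X t ω) / n - m} ∪ {ω | ε ≤ (∑ t, (1 - X t ω)) / n - (1 - m)} := by
    intro ω hω
    simp only [Set.mem_ofPred_eq, Set.mem_union] at hω ⊢
    have : (∑ t, (1 - X t ω)) / n - (1 - m) = -((∑ t, X t ω) / n - m) := by
      simp only [Finset.sum_sub_distrib, Finset.sum_const, Finset.card_univ, Fintype.card_fin,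
        nsmul_eq_mul]
      field_simp
      ring
    rw [this]
    exact le_abs.mp hω
  calc _ ≤ _ := measureReal_mono hset
    _ ≤ _ := measureReal_union_le _ _
    _ ≤ _ := by linarith

theorem IsTripletSample.measureReal_abs_jointFreq_sub_ge_le {Ω : Type*} [MeasurableSpace Ω]
    {μ : Measure Ω} [IsProbabilityMeasure μ] {ρ n : ℕ} {p : ℝ} {y₁ y₂ : Ranking ρ}
    {θ : Fin 3 → ℝ} {Y : Fin n → Ω → Ranking ρ} {L : Fin n → Fin 3 → Ω → Ranking ρ}
    (h : IsTripletSample μ p y₁ y₂ θ Y L) (hy : y₁ ≠ y₂) (hn : 0 < n) (s r : Fin 3)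
    (e : ItemPair ρ) {ε : ℝ} (hε : 0 ≤ ε) :
    μ.real {ω | ε ≤ |jointFreq (fun t u => L t u ω) s r e - jointProb p y₁ y₂ θ s r e|} ≤
      2 * Real.exp (-(2 * n * ε ^ 2)) := by
  have hmeasSet : ∀ t, MeasurableSet {ω | embed (L t s ω) e = 1 ∧ embed (L t r ω) e = 1} :=
    fun t => (h.measurable_output t s (MeasurableSet.of_discrete (s := {π | embed π e = 1}))).inter
      (h.measurable_output t r (MeasurableSet.of_discrete (s := {π | embed π e = 1})))
  refine measureReal_abs_mean_sub_ge_le hn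
    (X := fun t ω => if embed (L t s ω) e = 1 ∧ embed (L t r ω) e = 1 then (1 : ℝ) else 0)
    (fun t => Measurable.ite (hmeasSet t) measurable_const measurable_const) ?_ ?_ ?_ hε
  · exact h.indep.comp (fun _ (x : Ranking ρ × (Fin 3 → Ranking ρ)) =>
      if embed (x.2 s) e = 1 ∧ embed (x.2 r) e = 1 then (1 : ℝ) else 0)
      fun _ => measurable_of_countable _
  · intro t ω
    split_ifs <;> simp
  · intro t
    rw [← h.measureReal_embed_eq_one hy t s r e, ← integral_indicator_one (hmeasSet t)]
    refine integral_congr_ae (ae_of_all _ fun ω => ?_)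
    simp [Set.indicator_apply]

/-! ### Perturbation of the quadratic triplet estimates -/

theorem abs_cov_sub_le {o o₀ a a₀ b b₀ ε : ℝ} (ho : |o - o₀| ≤ ε) (ha : |a - a₀| ≤ ε)
    (hb : |b - b₀| ≤ ε) (ha1 : |a| ≤ 1) (hb1 : |b₀| ≤ 1) :
    |(o - a * b) - (o₀ - a₀ * b₀)| ≤ 3 * ε := by
  have h : (o - a * b) - (o₀ - a₀ * b₀) = (o - o₀) - a * (b - b₀) - (a - a₀) * b₀ := by ring
  have h1 : |a * (b - b₀)| ≤ 1 * ε := by rw [abs_mul]; gcongr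
  have h2 : |(a - a₀) * b₀| ≤ ε * 1 := by
    rw [abs_mul]
    exact mul_le_mul ha hb1 (abs_nonneg _) ((abs_nonneg _).trans ha)
  rw [h]
  calc _ ≤ |o - o₀ - a * (b - b₀)| + |(a - a₀) * b₀| := abs_sub _ _
    _ ≤ |o - o₀| + |a * (b - b₀)| + |(a - a₀) * b₀| := by gcongr; exact abs_sub _ _
    _ ≤ _ := by linarith

/-- At the exact covariances the radicand is `(D u)²`. Since `√x + D u ≥ 7 D / 8`, dividing `|x - (D
u)²|` by it costs only a constant: the root loses no power of `ε`. -/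
theorem abs_sqrt_cov_sub_le {D u v w ε X Y Z : ℝ} (hD : 0 < D)
    (hu : 7 / 8 ≤ u) (hu1 : u ≤ 1) (hv : 7 / 8 ≤ v) (hv1 : v ≤ 1) (hw : 7 / 8 ≤ w) (hw1 : w ≤ 1)
    (hε : 12 * ε ≤ D) (hX : |X - D * u * v| ≤ 3 * ε) (hY : |Y - D * u * w| ≤ 3 * ε)
    (hZ : |Z - D * v * w| ≤ 3 * ε) :
    |Real.sqrt (D * (X * Y / Z)) - D * u| ≤ 28 * ε := by
  have hlow : ∀ {a b : ℝ}, 7 / 8 ≤ a → 7 / 8 ≤ b → 49 / 64 * D ≤ D * a * b := by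
    intro a b ha hb
    have : (7 / 8 : ℝ) * (7 / 8) ≤ a * b := by gcongr
    nlinarith
  have hup : ∀ {a b : ℝ}, 7 / 8 ≤ a → a ≤ 1 → 7 / 8 ≤ b → b ≤ 1 → D * a * b ≤ D := by
    intro a b ha ha1 hb hb1
    have : a * b ≤ 1 * 1 := by gcongr
    nlinarith
  have hε0 : 0 ≤ ε := by linarith [abs_nonneg (X - D * u * v)]
  have hX0 : 0 ≤ X := by linarith [(abs_le.mp hX).1, hlow hu hv]
  have hY0 : 0 ≤ Y := by linarith [(abs_le.mp hY).1, hlow hu hw]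
  have hZ0 : D / 2 ≤ Z := by linarith [(abs_le.mp hZ).1, hlow hv hw]
  have hZpos : 0 < Z := by linarith
  have hY2 : |Y| ≤ 2 * D := by
    rw [abs_of_nonneg hY0]; linarith [(abs_le.mp hY).2, hup hu hu1 hw hw1]
  -- This combination vanishes at the exact values, so it is linear in the errors.
  have hnum : |X * Y - D * u * u * Z| ≤ 12 * ε * D := by
    have h : X * Y - D * u * u * Z =
        (X - D * u * v) * Y + D * u * v * (Y - D * u * w) - D * u * u * (Z - D * v * w) := by ring
    have h1 : |(X - D * u * v) * Y| ≤ 3 * ε * (2 * D) := by rw [abs_mul]; gcongr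
    have h2 : |D * u * v * (Y - D * u * w)| ≤ D * (3 * ε) := by
      rw [abs_mul, abs_of_nonneg (by linarith [hlow hu hv] : 0 ≤ D * u * v)]
      exact mul_le_mul (hup hu hu1 hv hv1) hY (abs_nonneg _) hD.le
    have h3 : |D * u * u * (Z - D * v * w)| ≤ D * (3 * ε) := by
      rw [abs_mul, abs_of_nonneg (by linarith [hlow hu hu] : 0 ≤ D * u * u)]
      exact mul_le_mul (hup hu hu1 hu hu1) hZ (abs_nonneg _) hD.le
    rw [h]
    calc _ ≤ |(X - D * u * v) * Y + D * u * v * (Y - D * u * w)| +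
          |D * u * u * (Z - D * v * w)| := abs_sub _ _
      _ ≤ |(X - D * u * v) * Y| + |D * u * v * (Y - D * u * w)| +
          |D * u * u * (Z - D * v * w)| := by gcongr; exact abs_add_le _ _
      _ ≤ _ := by linarith
  set x := D * (X * Y / Z) with hx
  have hx0 : 0 ≤ x := by positivity
  have hdiff : |x - (D * u) ^ 2| ≤ 24 * D * ε := by
    have h : x - (D * u) ^ 2 = D * (X * Y - D * u * u * Z) / Z := by
      rw [hx]; field_simp
    rw [h, abs_div, abs_mul, abs_of_pos hD, abs_of_pos hZpos, div_le_iff₀ hZpos]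
    have h1 := mul_le_mul_of_nonneg_left hnum hD.le
    have h2 : 24 * D * ε * (D / 2) ≤ 24 * D * ε * Z := by gcongr
    linarith
  have hfac : x - (D * u) ^ 2 = (Real.sqrt x - D * u) * (Real.sqrt x + D * u) := by
    rw [← Real.sq_sqrt hx0]
    simp only [Real.sqrt_sq (Real.sqrt_nonneg x)]
    ring
  have hpos : 7 / 8 * D ≤ Real.sqrt x + D * u := by
    have := Real.sqrt_nonneg x
    nlinarith
  rw [hfac, abs_mul, abs_of_nonneg (by linarith : 0 ≤ Real.sqrt x + D * u)] at hdiff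
  have h1 := mul_le_mul_of_nonneg_left hpos (abs_nonneg (Real.sqrt x - D * u))
  have h2 : D * |Real.sqrt x - D * u| ≤ D * (28 * ε) := by nlinarith
  exact le_of_mul_le_mul_left h2 hD

theorem mul_sqrt_div_mul {p q R : ℝ} (hp : 0 < p) :
    p * Real.sqrt (q / p * R) = Real.sqrt (p * q * R) := by
  have h : p * q * R = p ^ 2 * (q / p * R) := by field_simp
  rw [h, Real.sqrt_mul (sq_nonneg p), Real.sqrt_sq hp.le]

theorem jointProb_self {ρ : ℕ} (p : ℝ) (y₁ y₂ : Ranking ρ) (θ : Fin 3 → ℝ) (s : Fin 3)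
    (e : ItemPair ρ) : jointProb p y₁ y₂ θ s s e =
      p * coordProb (θ s) y₁ e + (1 - p) * coordProb (θ s) y₂ e := by
  fin_cases s <;> simp [jointProb]

theorem jointProb_of_ne {ρ : ℕ} (p : ℝ) (y₁ y₂ : Ranking ρ) (θ : Fin 3 → ℝ) {s r : Fin 3}
    (hsr : s ≠ r) (e : ItemPair ρ) : jointProb p y₁ y₂ θ s r e =
      p * (coordProb (θ s) y₁ e * coordProb (θ r) y₁ e) +
        (1 - p) * (coordProb (θ s) y₂ e * coordProb (θ r) y₂ e) := by
  unfold jointProb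
  fin_cases s <;> fin_cases r <;> simp [Fin.prod_univ_three] at hsr ⊢ <;> ring

/-- With the diagonal included, one concentration bound over ordered pairs of sources covers single
and joint frequencies. -/
theorem freq_eq_jointFreq {ρ n : ℕ} (data : Fin n → Fin 3 → Ranking ρ) (s : Fin 3)
    (e : ItemPair ρ) : freq data s e = jointFreq data s s e := by
  simp [freq, jointFreq]

theorem abs_freq_le_one {ρ n : ℕ} (data : Fin n → Fin 3 → Ranking ρ) (s : Fin 3)
    (e : ItemPair ρ) : |freq data s e| ≤ 1 := by
  have h0 : 0 ≤ ∑ t : Fin n, if embed (data t s) e = 1 then (1 : ℝ) else 0 :=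
    Finset.sum_nonneg fun t _ => by split_ifs <;> norm_num
  have h1 : ∑ t : Fin n, (if embed (data t s) e = 1 then (1 : ℝ) else 0) ≤ n := by
    calc _ ≤ ∑ _t : Fin n, (1 : ℝ) := Finset.sum_le_sum fun t _ => by split_ifs <;> norm_num
      _ = n := by simp
  unfold freq
  rw [abs_of_nonneg (by positivity)]
  exact div_le_one_of_le₀ h1 n.cast_nonneg

section PairEstimate

variable {ρ n : ℕ} {p ε : ℝ} {y₁ y₂ : Ranking ρ} {θ : Fin 3 → ℝ}
  {σ : Fin 3 → ItemPair ρ → ℤˣ} {data : Fin n → Fin 3 → Ranking ρ} {e : ItemPair ρ}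

/-- The covariance in a mixture of two product laws is `p (1 - p)` times the product of the
differences of the class means. -/
theorem abs_empiricalCov_sub_le (hp0 : 0 < p) (hp1 : p < 1)
    (hclose : ∀ s r, |jointFreq data s r e - jointProb p y₁ y₂ θ s r e| ≤ ε) {s r : Fin 3}
    (hsr : s ≠ r) :
    |(jointFreq data s r e - freq data s e * freq data r e) -
      p * (1 - p) * (coordProb (θ s) y₁ e - coordProb (θ s) y₂ e) *
        (coordProb (θ r) y₁ e - coordProb (θ r) y₂ e)| ≤ 3 * ε := by
  have hcov : p * (1 - p) * (coordProb (θ s) y₁ e - coordProb (θ s) y₂ e) *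
        (coordProb (θ r) y₁ e - coordProb (θ r) y₂ e) =
      jointProb p y₁ y₂ θ s r e - jointProb p y₁ y₂ θ s s e * jointProb p y₁ y₂ θ r r e := by
    rw [jointProb_of_ne p y₁ y₂ θ hsr, jointProb_self, jointProb_self]; ring
  rw [hcov]
  refine abs_cov_sub_le (hclose s r) ?_ ?_ (abs_freq_le_one data s e) ?_
  · rw [freq_eq_jointFreq]; exact hclose s s
  · rw [freq_eq_jointFreq]; exact hclose r r
  · rw [jointProb_self, abs_le]
    have h1 := coordProb_nonneg (θ r) y₁ e
    have h2 := coordProb_nonneg (θ r) y₂ e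
    have h3 := coordProb_le_one (θ r) y₁ e
    have h4 := coordProb_le_one (θ r) y₂ e
    constructor <;> nlinarith

/-- The square root in the quadratic formula, scaled by the class probability. -/
noncomputable def scaledRoot (p : ℝ) (o : TripletObs) : ℝ :=
  Real.sqrt (p * (1 - p) *
    ((o.Oab - o.la * o.lb) * (o.Oac - o.la * o.lc) / (o.Obc - o.lb * o.lc)))

theorem mul_accuracy₁ (hp0 : 0 < p) (s : Fin 3) :
    p * accuracy₁ p σ data s e =
      p * freq data s e + ((σ s e : ℤ) : ℝ) * scaledRoot p (tripletObs data s e) := by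
  rw [scaledRoot, ← mul_sqrt_div_mul hp0]
  simp only [accuracy₁, quadraticTriplets, quadraticRoot, tripletObs]
  ring

/-- Here the root is the same as in `mul_accuracy₁`, with opposite sign: this is the source of the
cancellation on pairs where the two centres agree. -/
theorem mul_accuracy₂ (hp1 : p < 1) (s : Fin 3) :
    (1 - p) * accuracy₂ p σ data s e =
      (1 - p) * freq data s e - ((σ s e : ℤ) : ℝ) * scaledRoot p (tripletObs data s e) := by
  rw [scaledRoot, mul_comm p, ← mul_sqrt_div_mul (sub_pos.mpr hp1)]
  simp only [accuracy₂, quadraticTriplets, quadraticRoot, tripletObs, sub_sub_cancel,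
    Units.val_neg, Int.cast_neg]
  ring

/-- `ν` is the sign of the accuracy differences, common to the three sources; covariances are
products of two differences and do not see it. -/
theorem abs_scaledRoot_sub_le (hp0 : 0 < p) (hp1 : p < 1) (hε : 12 * ε ≤ p * (1 - p))
    (hclose : ∀ s r, |jointFreq data s r e - jointProb p y₁ y₂ θ s r e| ≤ ε) {ν : ℝ}
    (hν : ν * ν = 1)
    (hu : ∀ s, 7 / 8 ≤ ν * (coordProb (θ s) y₁ e - coordProb (θ s) y₂ e))
    (hu1 : ∀ s, ν * (coordProb (θ s) y₁ e - coordProb (θ s) y₂ e) ≤ 1) (s : Fin 3) :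
    |scaledRoot p (tripletObs data s e) -
      p * (1 - p) * (ν * (coordProb (θ s) y₁ e - coordProb (θ s) y₂ e))| ≤ 28 * ε := by
  have hcov : ∀ r t : Fin 3, r ≠ t → |(jointFreq data r t e - freq data r e * freq data t e) -
      p * (1 - p) * (ν * (coordProb (θ r) y₁ e - coordProb (θ r) y₂ e)) *
        (ν * (coordProb (θ t) y₁ e - coordProb (θ t) y₂ e))| ≤ 3 * ε := by
    intro r t hrt
    have h := abs_empiricalCov_sub_le hp0 hp1 hclose hrt
    have hring : p * (1 - p) * (ν * (coordProb (θ r) y₁ e - coordProb (θ r) y₂ e)) *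
        (ν * (coordProb (θ t) y₁ e - coordProb (θ t) y₂ e)) = (ν * ν) * (p * (1 - p) *
        (coordProb (θ r) y₁ e - coordProb (θ r) y₂ e) *
        (coordProb (θ t) y₁ e - coordProb (θ t) y₂ e)) := by ring
    rwa [hring, hν, one_mul]
  exact abs_sqrt_cov_sub_le (mul_pos hp0 (sub_pos.mpr hp1)) (hu s) (hu1 s) (hu (s + 1))
    (hu1 (s + 1)) (hu (s + 2)) (hu1 (s + 2)) hε (hcov s (s + 1) (by fin_cases s <;> decide))
    (hcov s (s + 2) (by fin_cases s <;> decide))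
    (hcov (s + 1) (s + 2) (by fin_cases s <;> decide))

theorem abs_pairEstimate_sub_le (hp0 : 0 < p) (hp1 : p < 1) (hε : 12 * ε ≤ p * (1 - p))
    (hθ0 : ∀ s, 0 ≤ θ s) (hθ : ∀ s, Real.exp (-θ s) ≤ 1 / 16) (hσ : CorrectSigns θ y₁ y₂ σ)
    (hclose : ∀ s r, |jointFreq data s r e - jointProb p y₁ y₂ θ s r e| ≤ ε) (s : Fin 3) :
    |(p * disagreement y₁ e (accuracy₁ p σ data s e)
        + (1 - p) * disagreement y₂ e (accuracy₂ p σ data s e)) -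
      (p * disagreement y₁ e (coordProb (θ s) y₁ e)
        + (1 - p) * disagreement y₂ e (coordProb (θ s) y₂ e))| ≤ 57 * ε := by
  have h1 := mul_accuracy₁ (σ := σ) (data := data) (e := e) hp0 s
  have h2 := mul_accuracy₂ (σ := σ) (data := data) (e := e) hp1 s
  have hl := hclose s s
  rw [← freq_eq_jointFreq, jointProb_self] at hl
  have hε0 : 0 ≤ ε := (abs_nonneg _).trans hl
  obtain ⟨hl1, hl2⟩ := abs_le.mp hl
  set l := freq data s e
  -- Where the centres differ, the estimate is affine in `l` with slope `±(1 - 2p)` and contains the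
  -- scaled root twice, whence `57 = 1 + 2 * 28`.
  have hpl : |(1 - 2 * p) * (l - (p * coordProb (θ s) y₁ e + (1 - p) * coordProb (θ s) y₂ e))| ≤
      1 * ε := by
    rw [abs_mul]
    have : |1 - 2 * p| ≤ 1 := by rw [abs_le]; constructor <;> linarith
    gcongr
  obtain ⟨hpl1, hpl2⟩ := abs_le.mp hpl
  have hsgn := hσ s e
  by_cases e1 : embed y₁ e = 1 <;> by_cases e2 : embed y₂ e = 1 <;>
    simp only [disagreement, e1, e2, if_true, if_false]
  · rw [abs_le]; constructor <;> linarith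
  · have hA : ∀ r, 15 / 16 ≤ coordProb (θ r) y₁ e := fun r => by
      linarith [one_sub_exp_le_coordProb (hθ0 r) e1, hθ r]
    have hB : ∀ r, coordProb (θ r) y₂ e ≤ 1 / 16 := fun r =>
      (coordProb_le_exp (hθ0 r) e2).trans (hθ r)
    have hroot := abs_scaledRoot_sub_le hp0 hp1 hε hclose (ν := 1) (by norm_num)
      (fun r => by linarith [hA r, hB r])
      (fun r => by linarith [coordProb_le_one (θ r) y₁ e, coordProb_nonneg (θ r) y₂ e]) s
    obtain ⟨hr1, hr2⟩ := abs_le.mp hroot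
    -- The gap of the accuracies is nonzero, so the correct sign is forced.
    have hs1 : ((σ s e : ℤ) : ℝ) = 1 := by
      rcases Int.units_eq_one_or (σ s e) with h | h
      · simp [h]
      · simp only [h, Units.val_neg, Units.val_one, Int.cast_neg, Int.cast_one] at hsgn
        linarith [hA s, hB s]
    rw [hs1] at h1 h2
    rw [abs_le]; constructor <;> nlinarith
  · have hA : ∀ r, 15 / 16 ≤ coordProb (θ r) y₂ e := fun r => by
      linarith [one_sub_exp_le_coordProb (hθ0 r) e2, hθ r]
    have hB : ∀ r, coordProb (θ r) y₁ e ≤ 1 / 16 := fun r =>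
      (coordProb_le_exp (hθ0 r) e1).trans (hθ r)
    have hroot := abs_scaledRoot_sub_le hp0 hp1 hε hclose (ν := -1) (by norm_num)
      (fun r => by linarith [hA r, hB r])
      (fun r => by linarith [coordProb_le_one (θ r) y₂ e, coordProb_nonneg (θ r) y₁ e]) s
    obtain ⟨hr1, hr2⟩ := abs_le.mp hroot
    have hs1 : ((σ s e : ℤ) : ℝ) = -1 := by
      rcases Int.units_eq_one_or (σ s e) with h | h
      · simp only [h, Units.val_one, Int.cast_one] at hsgn
        linarith [hA s, hB s]
      · simp [h]
    rw [hs1] at h1 h2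
    rw [abs_le]; constructor <;> nlinarith
  · rw [abs_le]; constructor <;> linarith

end PairEstimate

theorem abs_meanEstimate_sub_le {ρ n : ℕ} {p ε : ℝ} {y₁ y₂ : Ranking ρ} {θ : Fin 3 → ℝ}
    {σ : Fin 3 → ItemPair ρ → ℤˣ} {data : Fin n → Fin 3 → Ranking ρ} (hp0 : 0 < p) (hp1 : p < 1)
    (hε : 12 * ε ≤ p * (1 - p)) (hθ0 : ∀ s, 0 ≤ θ s) (hθ : ∀ s, Real.exp (-θ s) ≤ 1 / 16)
    (hσ : CorrectSigns θ y₁ y₂ σ)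
    (hclose : ∀ s r e, |jointFreq data s r e - jointProb p y₁ y₂ θ s r e| ≤ ε) (s : Fin 3) :
    |meanEstimate p y₁ y₂ σ data s - meanDist ρ (θ s)| ≤ ρ.choose 2 * (57 * ε) := by
  have hmean : meanDist ρ (θ s) = ∑ e : ItemPair ρ,
      (p * disagreement y₁ e (coordProb (θ s) y₁ e)
        + (1 - p) * disagreement y₂ e (coordProb (θ s) y₂ e)) := by
    rw [Finset.sum_add_distrib, ← Finset.mul_sum, ← Finset.mul_sum, sum_disagreement_coordProb,
      sum_disagreement_coordProb]
    ring
  rw [hmean, meanEstimate, ← Finset.sum_sub_distrib]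
  calc _ ≤ ∑ e : ItemPair ρ, _ := Finset.abs_sum_le_sum_abs _ _
    _ ≤ ∑ _e : ItemPair ρ, 57 * ε := Finset.sum_le_sum fun e _ =>
        abs_pairEstimate_sub_le hp0 hp1 hε hθ0 hθ hσ (fun s r => hclose s r e) s
    _ = _ := by rw [Finset.sum_const, Finset.card_univ, card_itemPair, nsmul_eq_mul]

/-! ### The statistical rate -/

theorem rate_nonneg (ρ n : ℕ) {δ : ℝ} (hδ : 0 < δ) : 0 ≤ rate ρ n δ := by
  rcases Nat.eq_zero_or_pos ρ with rfl | hρ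
  · simp [rate, Real.zero_rpow]
  have h1 : (1 : ℝ) ≤ ρ := by exact_mod_cast hρ
  have : 0 ≤ Real.log (2 * (ρ : ℝ) ^ 2) := Real.log_nonneg (by nlinarith)
  unfold rate
  positivity

/-- With `l = log (2ρ²) ≥ 1` the exponent is `4 l / δ`, at least `3 l + 1 / δ`. The first part beats
the number of events, the second gives `exp (-1/δ) ≤ δ`. -/
theorem eighteen_mul_choose_mul_exp_le {ρ n : ℕ} {δ : ℝ} (hρ : 2 ≤ ρ) (hn : 0 < n) (hδ : 0 < δ)
    (hδ1 : δ ≤ 1) :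
    18 * (ρ.choose 2 : ℝ) * Real.exp (-(2 * n * (2 * rate ρ n δ ^ 2) ^ 2)) ≤ δ := by
  have hρ' : (2 : ℝ) ≤ ρ := by exact_mod_cast hρ
  have hn' : (0 : ℝ) < n := by exact_mod_cast hn
  have h8 : (8 : ℝ) ≤ 2 * (ρ : ℝ) ^ 2 := by nlinarith
  set l := Real.log (2 * (ρ : ℝ) ^ 2) with hl
  have hl1 : 1 ≤ l := by
    rw [hl, Real.le_log_iff_exp_le (by linarith)]
    linarith [Real.exp_one_lt_d9]
  have hrate : rate ρ n δ ^ 4 = l / (2 * δ * n) := by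
    rw [rate, ← Real.rpow_natCast, ← Real.rpow_mul (by positivity), ← hl]
    norm_num
  have hexp : 2 * n * (2 * rate ρ n δ ^ 2) ^ 2 = 4 * (l / δ) := by
    calc _ = 8 * n * rate ρ n δ ^ 4 := by ring
      _ = _ := by rw [hrate]; field_simp; ring
  have hlδ : l ≤ l / δ := le_div_self (by linarith) hδ hδ1
  have hlδ' : 1 / δ ≤ l / δ := by gcongr
  have h1 : Real.exp (-(4 * (l / δ))) ≤ Real.exp (-(3 * l)) * Real.exp (-(1 / δ)) := by
    rw [← Real.exp_add, Real.exp_le_exp]; linarith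
  have h2 : Real.exp (-(1 / δ)) ≤ δ := by
    rw [Real.exp_neg, inv_le_comm₀ (Real.exp_pos _) hδ, ← one_div]
    linarith [Real.add_one_le_exp (1 / δ)]
  have h3 : Real.exp (-(3 * l)) = ((2 * (ρ : ℝ) ^ 2) ^ 3)⁻¹ := by
    rw [Real.exp_neg, show 3 * l = ((3 : ℕ) : ℝ) * l by norm_num, Real.exp_nat_mul, hl,
      Real.exp_log (by linarith)]
  have h4 : (ρ.choose 2 : ℝ) ≤ (ρ : ℝ) ^ 2 := by exact_mod_cast Nat.choose_le_pow ρ 2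
  rw [hexp]
  calc 18 * (ρ.choose 2 : ℝ) * Real.exp (-(4 * (l / δ)))
      ≤ 18 * (ρ : ℝ) ^ 2 * (((2 * (ρ : ℝ) ^ 2) ^ 3)⁻¹ * δ) := by
        rw [h3] at h1
        gcongr
        exact h1.trans (by gcongr)
    _ = 18 * (ρ : ℝ) ^ 2 / (2 * (ρ : ℝ) ^ 2) ^ 3 * δ := by ring
    _ ≤ 1 * δ := by
        gcongr
        rw [div_le_one (by positivity)]
        have : (2 * (ρ : ℝ) ^ 2) ^ 3 = (2 * (ρ : ℝ) ^ 2) ^ 2 * (2 * (ρ : ℝ) ^ 2) := by ring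
        rw [this]
        have : (8 : ℝ) ^ 2 ≤ (2 * (ρ : ℝ) ^ 2) ^ 2 := by gcongr
        nlinarith
    _ = δ := one_mul δ

/-- The factor 18 counts nine ordered pairs of sources and two tails. Covering the space by the good
and bad events uses subadditivity only, so no event has to be measurable. -/
theorem IsTripletSample.one_sub_le_measureReal_close {Ω : Type*} [MeasurableSpace Ω]
    {μ : Measure Ω} [IsProbabilityMeasure μ] {ρ n : ℕ} {p : ℝ} {y₁ y₂ : Ranking ρ}
    {θ : Fin 3 → ℝ} {Y : Fin n → Ω → Ranking ρ} {L : Fin n → Fin 3 → Ω → Ranking ρ}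
    (h : IsTripletSample μ p y₁ y₂ θ Y L) (hy : y₁ ≠ y₂) (hn : 0 < n) {ε : ℝ} (hε : 0 ≤ ε) :
    1 - 18 * (ρ.choose 2 : ℝ) * Real.exp (-(2 * n * ε ^ 2)) ≤
      μ.real {ω | ∀ s r e, |jointFreq (fun t u => L t u ω) s r e -
        jointProb p y₁ y₂ θ s r e| ≤ ε} := by
  set bad : Fin 3 × Fin 3 × ItemPair ρ → Set Ω := fun x =>
    {ω | ε ≤ |jointFreq (fun t u => L t u ω) x.1 x.2.1 x.2.2 -
      jointProb p y₁ y₂ θ x.1 x.2.1 x.2.2|} with hbad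
  set good := {ω | ∀ s r e, |jointFreq (fun t u => L t u ω) s r e -
        jointProb p y₁ y₂ θ s r e| ≤ ε}
  have hcover : (Set.univ : Set Ω) ⊆ good ∪ ⋃ x, bad x := by
    intro ω _
    by_cases hω : ω ∈ good
    · exact Or.inl hω
    · right
      by_contra hb
      refine hω fun s r e => ?_
      by_contra hlt
      exact hb (Set.mem_iUnion.mpr ⟨(s, r, e), (not_le.mp hlt).le⟩)
  have hsum : μ.real (⋃ x, bad x) ≤ 18 * (ρ.choose 2 : ℝ) * Real.exp (-(2 * n * ε ^ 2)) := by
    calc μ.real (⋃ x, bad x) ≤ ∑ x, μ.real (bad x) := measureReal_iUnion_fintype_le _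
      _ ≤ ∑ _x : Fin 3 × Fin 3 × ItemPair ρ, 2 * Real.exp (-(2 * n * ε ^ 2)) :=
          Finset.sum_le_sum fun x _ =>
            h.measureReal_abs_jointFreq_sub_ge_le hy hn x.1 x.2.1 x.2.2 hε
      _ = _ := by
          rw [Finset.sum_const, Finset.card_univ, Fintype.card_prod, Fintype.card_prod,
            card_itemPair, Fintype.card_fin, nsmul_eq_mul]
          push_cast
          ring
  have h1 : (1 : ℝ) = μ.real Set.univ := by simp
  have h2 := (measureReal_mono hcover (measure_ne_top μ _)).trans
    (measureReal_union_le (μ := μ) good (⋃ x, bad x))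
  linarith

theorem two_le_of_ranking_ne {ρ : ℕ} {y₁ y₂ : Ranking ρ} (hy : y₁ ≠ y₂) : 2 ≤ ρ := by
  by_contra h
  have : Subsingleton (Fin ρ) := Fin.subsingleton_iff_le_one.mpr (by omega)
  exact hy (Equiv.ext fun a => Subsingleton.elim _ _)

end RankingWS

open RankingWS

/-! ### Assembly of the theorem. -/

theorem mainTheorem2 (p : ℝ) (hp0 : 0 < p) (hp1 : p < 1) :
    ∃ C : ℝ, 0 < C ∧
      ∀ (ρ n : ℕ) (y₁ y₂ : Ranking ρ) (δ U : ℝ) (θ : Fin 3 → ℝ)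
        (σ : Fin 3 → ItemPair ρ → ℤˣ)
        (Ω : Type*) (mΩ : MeasurableSpace Ω) (μ : Measure Ω) (_ : IsProbabilityMeasure μ)
        (Y : Fin n → Ω → Ranking ρ) (L : Fin n → Fin 3 → Ω → Ranking ρ),
        0 < n → y₁ ≠ y₂ → 0 < δ → 0 < U →
        (∀ s, 4 * Real.log 2 < θ s ∧ θ s < U) →
        CorrectSigns θ y₁ y₂ σ →
        IsTripletSample μ p y₁ y₂ θ Y L →
        1 - δ ≤ μ.real {ω | ∀ s : Fin 3,
          (C * (ρ.choose 2 : ℝ) * rate ρ n δ < meanDist ρ (θ s) →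
            |thetaEstimate p y₁ y₂ σ (fun t r => L t r ω) s - θ s| ≤
              backwardMap ρ (meanDist ρ (θ s) - C * (ρ.choose 2 : ℝ) * rate ρ n δ) - θ s) ∧
          (2 * (C * (ρ.choose 2 : ℝ) * rate ρ n δ) ≤ meanDist ρ U →
            |thetaEstimate p y₁ y₂ σ (fun t r => L t r ω) s - θ s| ≤
              C * (ρ.choose 2 : ℝ) * rate ρ n δ / |gDeriv ρ U|)} := by
  set D := p * (1 - p) with hD
  have hDpos : 0 < D := mul_pos hp0 (sub_pos.mpr hp1)
  have hD4 : D ≤ 1 / 4 := by nlinarith [sq_nonneg (p - 1 / 2)]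
  -- The constant must exceed `114 * 128` (estimation error times the slack for inversion) and make
  -- `C * rate ≥ 1` as soon as `24 * rate ^ 2 > D`.
  refine ⟨20000 / D, by positivity, ?_⟩
  intro ρ n y₁ y₂ δ U θ σ Ω mΩ μ _ Y L hn hy hδ hU hθ hσ hsample
  rcases lt_or_ge 1 δ with hδ1 | hδ1
  · linarith [measureReal_nonneg (μ := μ) (s := {ω | ∀ s : Fin 3,
          (20000 / D * (ρ.choose 2 : ℝ) * rate ρ n δ < meanDist ρ (θ s) →
            |thetaEstimate p y₁ y₂ σ (fun t r => L t r ω) s - θ s| ≤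
              backwardMap ρ (meanDist ρ (θ s) - 20000 / D * (ρ.choose 2 : ℝ) * rate ρ n δ) - θ s) ∧
          (2 * (20000 / D * (ρ.choose 2 : ℝ) * rate ρ n δ) ≤ meanDist ρ U →
            |thetaEstimate p y₁ y₂ σ (fun t r => L t r ω) s - θ s| ≤
              20000 / D * (ρ.choose 2 : ℝ) * rate ρ n δ / |gDeriv ρ U|)})]
  have hρ := two_le_of_ranking_ne hy
  have hchoose : (0 : ℝ) < ρ.choose 2 := by exact_mod_cast Nat.choose_pos hρ
  have hr0 := rate_nonneg ρ n hδ
  set r := rate ρ n δ with hr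
  have hθ0 : ∀ s, 0 ≤ θ s := fun s => by
    linarith [(hθ s).1, Real.log_nonneg (by norm_num : (1 : ℝ) ≤ 2)]
  have hθ16 : ∀ s, Real.exp (-θ s) ≤ 1 / 16 := fun s => by
    have h : Real.exp (-(4 * Real.log 2)) = 1 / 16 := by
      rw [Real.exp_neg, show 4 * Real.log 2 = ((4 : ℕ) : ℝ) * Real.log 2 by norm_num,
        Real.exp_nat_mul, Real.exp_log two_pos]
      norm_num
    rw [← h]
    exact Real.exp_le_exp.mpr (by linarith [(hθ s).1])
  have hprob := hsample.one_sub_le_measureReal_close hy hn (ε := 2 * r ^ 2) (by positivity)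
  have hunion := eighteen_mul_choose_mul_exp_le hρ hn hδ hδ1
  refine (by linarith : 1 - δ ≤ _).trans (hprob.trans (measureReal_mono ?_ (measure_ne_top μ _)))
  intro ω hω s
  set η := 20000 / D * (ρ.choose 2 : ℝ) * r with hη
  -- The perturbation bound needs `12 ε ≤ D` with `ε = 2 r²`. Otherwise `η` is at least the number
  -- of pairs, which bounds every mean, and neither premise can hold.
  rcases le_or_gt (24 * r ^ 2) D with hsmall | hlarge
  · have hr1 : r ≤ 1 := by nlinarith
    have hest := abs_meanEstimate_sub_le hp0 hp1 (by linarith : 12 * (2 * r ^ 2) ≤ p * (1 - p))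
      hθ0 hθ16 hσ hω s
    have hC : 114 * 128 ≤ 20000 / D := by
      rw [le_div_iff₀ hDpos]; linarith
    have hbound : |meanEstimate p y₁ y₂ σ (fun t r => L t r ω) s - meanDist ρ (θ s)| ≤
        η / 128 := by
      refine hest.trans ?_
      -- Here the rate `n^(-1/2)` obtained for the mean is given up for `n^(-1/4)`.
      have h1 : r ^ 2 ≤ r := by nlinarith
      calc (ρ.choose 2 : ℝ) * (57 * (2 * r ^ 2)) ≤ (ρ.choose 2 : ℝ) * (57 * (2 * r)) := by gcongr
        _ = 114 * 128 * (ρ.choose 2 : ℝ) * r / 128 := by ring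
        _ ≤ η / 128 := by rw [hη]; gcongr
    obtain ⟨m, rfl⟩ := Nat.exists_eq_add_of_le' (by omega : 1 ≤ ρ)
    have hm : 1 ≤ m := by omega
    exact ⟨fun h => abs_backwardMap_sub_le_backwardMap_sub hm (hθ16 s) h hbound,
      fun h => abs_backwardMap_sub_le_div_gDeriv hm (hθ16 s) (hθ s).2.le hU h hbound⟩
  · have hCr : 1 ≤ 20000 / D * r := by
      have h1 : D ≤ 20000 * r := by
        rcases le_total r 1 with h | h <;> nlinarith
      rw [div_mul_eq_mul_div, le_div_iff₀ hDpos]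
      linarith
    have hηle : (ρ.choose 2 : ℝ) ≤ η := by
      rw [hη, mul_right_comm]
      exact le_mul_of_one_le_left hchoose.le hCr
    refine ⟨fun h => absurd h (not_lt.mpr ((meanDist_le_choose ρ (θ s)).trans hηle)), fun h => ?_⟩
    linarith [meanDist_le_choose ρ U]
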